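/- Let $n,k$ be nonnegative integers, $N=nk$, and let $T$ be a standard Young tableau of rectangular shape with $n$ rows and $k$ columns, i.e. a bijective filling of the $n\times k$ rectangle with $1,\dots,N$ that strictly increases left to right in rows and top to bottom in columns. The evacuation $E(T)$ is obtained from $T$ as follows. Repeat until all entries are negative: remove the entry $a$ of the northwest corner; perform jeu de taquin slides (the lesser of the positive entries directly right of and directly below the empty cell moves into the empty cell) until no slide is possible; write $-a$ in the empty cell, where it stays fixed. Then add $N+1$ to all entries. For a standard Young tableau $S$ of shape $n\times k$, let $\mathcal M^S=(\mathcal M^S_1,\dots,\mathcal M^S_{n-1})$ be the multicolored noncrossing matching of $S$: the arcs of color $x$ are obtained by reading the entries $j$ of row $x+1$ from left to right and pairing each $j$ with the rightmost entry $i$ of row $x$ that is smaller than $j$ and not yet paired, which gives the arc $(i,j)\in\mathcal M^S_x$. The reflection $\varphi(\mathcal M)$ of a multicolored matching $\mathcal M$ is obtained by replacing each arc $(i,j)$ of color $x$ by the arc $(N+1-j,N+1-i)$ of color $n-x$. Then $E(T)$ is again a standard Young tableau of shape $n\times k$, and for every color $x\in\{1,\dots,n-1\}$ and all integers $i,j$,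 \[ (i,j)\in\mathcal M^T_x \quad\Longleftrightarrow\quad (N+1-j,\;N+1-i)\in\mathcal M^{E(T)}_{n-x}. \] In other words, $\varphi(\mathcal M^T)=\mathcal M^{E(T)}$. -/

import Mathlib

namespace RectTableau

/-- A filling of cells by integers. Cells are `(row, column)`, both numbered from `1`, rows from top
to bottom and columns from left to right. Only the cells of the rectangle under consideration
are ever read. -/
abbrev Filling := ℕ × ℕ → ℤ

/-- The cells of the rectangular Young diagram with `n` rows and `k` columns. -/
def cells (n k : ℕ) : Finset (ℕ × ℕ) := Finset.Icc 1 n ×ˢ Finset.Icc 1 k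

/-- `T` is a standard Young tableau of rectangular shape `n × k`: a bijective filling with
`1, …, n * k` that strictly increases left to right in rows and top to bottom in columns. -/
structure IsSYT (n k : ℕ) (T : Filling) : Prop where
  bijOn : Set.BijOn T (cells n k) (Set.Icc (1 : ℤ) ((n : ℤ) * k))
  row_lt : ∀ r c c' : ℕ, (r, c) ∈ cells n k → (r, c') ∈ cells n k → c < c' → T (r, c) < T (r, c')
  col_lt : ∀ r r' c : ℕ, (r, c) ∈ cells n k → (r', c) ∈ cells n k → r < r' → T (r, c) < T (r', c)

/-- The empty cell is at `(r, c)` (the value of `f` there is disregarded). Perform jeu de taquin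
slides, moving the lesser of the entries directly below and directly to the right into the
empty cell, until no slide is possible; then write `v` into the empty cell. Cells outside the
`n × k` rectangle, and cells with nonpositive entries (which are fixed), take no part in slides. -/
def slideAndFill (n k : ℕ) (v : ℤ) (f : Filling) (r c : ℕ) : Filling :=
  if r + 1 ≤ n ∧ 0 < f (r + 1, c) ∧
      (c + 1 ≤ k ∧ 0 < f (r, c + 1) → f (r + 1, c) < f (r, c + 1)) then
    slideAndFill n k v (Function.update f (r, c) (f (r + 1, c))) (r + 1) c
  else if c + 1 ≤ k ∧ 0 < f (r, c + 1) then
    slideAndFill n k v (Function.update f (r, c) (f (r, c + 1))) r (c + 1)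
  else
    Function.update f (r, c) v
termination_by (n - r) + (k - c)

/-- One round of evacuation: remove the entry of the northwest corner, slide until the empty cell is
as far southeast as possible, and fill it with the negative of the removed entry. -/
def evacuationStep (n k : ℕ) (f : Filling) : Filling :=
  slideAndFill n k (-f (1, 1)) f 1 1

/-- The evacuation `E(T)`. Each round turns one positive entry into a negative one, so that all
entries are negative after exactly `N = n * k` rounds; then `N + 1` is added to all entries. -/
def evacuation (n k : ℕ) (T : Filling) : Filling :=
  fun p => (evacuationStep n k)^[n * k] T p + ((n : ℤ) * k + 1)

/-- The arcs `(i, j)` of color `x` made from the first `m` entries `j` of row `x + 1`, read left to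
right: each `j` is paired with the rightmost entry `i` of row `x` that is smaller than `j` and
not yet paired. (In a standard tableau such an `i` always exists.) -/
def arcsUpTo (k : ℕ) (T : Filling) (x : ℕ) : ℕ → Finset (ℤ × ℤ)
  | 0 => ∅
  | m + 1 =>
    let done := arcsUpTo k T x m
    let j := T (x + 1, m + 1)
    let available := (Finset.Icc 1 k).filter
      (fun c => T (x, c) < j ∧ ∀ a ∈ done, a.1 ≠ T (x, c))
    if h : available.Nonempty then insert (T (x, available.max' h), j) done else done

/-- A collection of colored arcs: `(x, i, j)` is the arc `(i, j)` with color `x`. -/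
abbrev ColoredArcs := Set (ℕ × ℤ × ℤ)

/-- The multicolored noncrossing matching `M^T` of an `n × k` tableau `T`, with the colors
`1, …, n - 1`. -/
def matching (n k : ℕ) (T : Filling) : ColoredArcs :=
  {a | 1 ≤ a.1 ∧ a.1 < n ∧ a.2 ∈ arcsUpTo k T a.1 k}

/-- The reflection of a collection of arcs with end points in `1, …, N` and colors in
`1, …, n - 1`: each arc `(i, j)` of color `x` becomes `(N + 1 - j, N + 1 - i)` of color `n - x`. -/
def reflection (n : ℕ) (N : ℤ) (M : ColoredArcs) : ColoredArcs :=
  (fun a : ℕ × ℤ × ℤ => (n - a.1, N + 1 - a.2.2, N + 1 - a.2.1)) '' M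

end RectTableau

namespace RectTableau

/-- The number of occurrences of the letter `y` in the word `w` at the positions in `(s, t]`. -/
def cnt (w : ℕ → ℕ) (s t y : ℕ) : ℕ := ((Finset.Ioc s t).filter (fun j => w j = y)).card

lemma cnt_self (w : ℕ → ℕ) (s y : ℕ) : cnt w s s y = 0 := by simp [cnt]

lemma cnt_succ (w : ℕ → ℕ) {s t : ℕ} (h : s ≤ t) (y : ℕ) :
    cnt w s (t + 1) y = cnt w s t y + if w (t + 1) = y then 1 else 0 := by
  have hI : Finset.Ioc s (t + 1) = insert (t + 1) (Finset.Ioc s t) := by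
    ext a; simp only [Finset.mem_Ioc, Finset.mem_insert]; omega
  unfold cnt
  rw [hI, Finset.filter_insert]
  split_ifs with h1
  · rw [Finset.card_insert_of_notMem (by simp)]
  · rfl

lemma cnt_add (w : ℕ → ℕ) {s t u : ℕ} (h : s ≤ t) (h' : t ≤ u) (y : ℕ) :
    cnt w s u y = cnt w s t y + cnt w t u y := by
  induction u, h' using Nat.le_induction with
  | base => simp [cnt_self]
  | succ u hu ih => rw [cnt_succ w (by omega), cnt_succ w hu, ih]; omega

lemma cnt_mono (w : ℕ → ℕ) {s t u : ℕ} (h : s ≤ t) (h' : t ≤ u) (y : ℕ) :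
    cnt w s t y ≤ cnt w s u y := by
  rw [cnt_add w h h']; omega

lemma cnt_pred (w : ℕ → ℕ) {s t : ℕ} (h : s < t) (y : ℕ) :
    cnt w s t y = cnt w s (t - 1) y + if w t = y then 1 else 0 := by
  obtain ⟨u, rfl⟩ : ∃ u, t = u + 1 := ⟨t - 1, by omega⟩
  exact cnt_succ w (by omega) y

lemma cnt_head (w : ℕ → ℕ) {s t : ℕ} (h : s < t) (y : ℕ) :
    cnt w s t y = cnt w (s + 1) t y + if w (s + 1) = y then 1 else 0 := by
  rw [cnt_add w (Nat.le_succ s) h, Nat.succ_eq_add_one, cnt_succ w le_rfl, cnt_self]; omega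

/-- The counts after the letter at position `q` is replaced by `x`. -/
lemma cnt_update (w : ℕ → ℕ) {s q : ℕ} (hq : s < q) (x t y : ℕ) (hst : s ≤ t) :
    (cnt (Function.update w q x) s t y : ℤ) + (if q ≤ t ∧ w q = y then 1 else 0) =
      cnt w s t y + if q ≤ t ∧ x = y then 1 else 0 := by
  induction t, hst using Nat.le_induction with
  | base => simp [cnt_self, show ¬ q ≤ s by omega]
  | succ t ht ih =>
    rw [cnt_succ _ ht, cnt_succ _ ht]
    by_cases h1 : q = t + 1
    · subst h1
      simp only [Function.update_self, Nat.le_refl, true_and, show ¬ t + 1 ≤ t by omega,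
        false_and, if_false] at ih ⊢
      push_cast; split_ifs at * <;> omega
    · rw [Function.update_of_ne (by omega)]
      simp only [show (q ≤ t + 1) = (q ≤ t) by apply propext; omega]
      push_cast; omega

lemma exists_occurrence (w : ℕ → ℕ) {s t y c : ℕ} (hst : s ≤ t) (h1 : 1 ≤ c)
    (h : c ≤ cnt w s t y) : ∃ j, s < j ∧ j ≤ t ∧ w j = y ∧ cnt w s j y = c := by
  induction t, hst using Nat.le_induction with
  | base => rw [cnt_self] at h; omega
  | succ t ht ih =>
    by_cases h2 : c ≤ cnt w s t y
    · obtain ⟨j, a, b, d⟩ := ih h2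
      exact ⟨j, a, by omega, d⟩
    · have h3 := cnt_succ w ht y
      split_ifs at h3 with h4
      · exact ⟨t + 1, by omega, le_rfl, h4, by omega⟩
      · omega

/-- A weakly decreasing family of `m`-element subsets `Φ t` of `{1, …, n}`, encoded by the numbers
`g t y` of elements of `Φ t` that are less than `y`. -/
structure IsFamily (n : ℕ) (m : ℤ) (g : ℕ → ℕ → ℤ) : Prop where
  bot : ∀ t, g t 1 = 0
  top : ∀ t, g t (n + 1) = m
  le_succ : ∀ t y, g t y ≤ g t (y + 1)
  succ_le : ∀ t y, g t (y + 1) ≤ g t y + 1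
  mono : ∀ t y, g t y ≤ g (t + 1) y

/-- The number of positions `t` in `(s, N]` whose letter lies in the `t`-th set of the family. -/
def score (w : ℕ → ℕ) (s N : ℕ) (g : ℕ → ℕ → ℤ) : ℤ :=
  ∑ t ∈ Finset.Ioc s N, (g t (w t + 1) - g t (w t))

/-- Some decreasing family of `m`-element subsets has score at least `K`. The largest such `K` is
the largest size of a union of `m` weakly decreasing subsequences. -/
def Reach (n : ℕ) (m : ℤ) (w : ℕ → ℕ) (s N : ℕ) (K : ℤ) : Prop :=
  ∃ g, IsFamily n m g ∧ K ≤ score w s N g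

lemma cnt_eq_sum (w : ℕ → ℕ) (s t y : ℕ) :
    (cnt w s t y : ℤ) = ∑ j ∈ Finset.Ioc s t, if w j = y then 1 else 0 := by
  simp [cnt]

lemma sum_Ioc_succ (d : ℕ → ℤ) {s t : ℕ} (h : s ≤ t) :
    ∑ j ∈ Finset.Ioc s (t + 1), d j = ∑ j ∈ Finset.Ioc s t, d j + d (t + 1) :=
  Finset.sum_Ioc_succ_top h d

lemma sum_Ioc_add (d : ℕ → ℤ) {s t u : ℕ} (h : s ≤ t) (h' : t ≤ u) :
    ∑ j ∈ Finset.Ioc s u, d j = ∑ j ∈ Finset.Ioc s t, d j + ∑ j ∈ Finset.Ioc t u, d j :=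
  (Finset.sum_Ioc_consecutive d h h').symm

lemma sum_initial_nonneg (d : ℕ → ℤ) (F : ℕ → Prop) [DecidablePred F] {q N : ℕ} (hqN : q ≤ N)
    (hF : ∀ t u, q < t → t ≤ u → F u → F t)
    (h : ∀ t, q ≤ t → t ≤ N → 0 ≤ ∑ j ∈ Finset.Ioc q t, d j) :
    0 ≤ ∑ j ∈ Finset.Ioc q N, if F j then d j else 0 := by
  induction N, hqN using Nat.le_induction with
  | base => simp
  | succ N hN ih =>
    by_cases hf : F (N + 1)
    · rw [Finset.sum_congr rfl (g := d)]
      · exact h (N + 1) (by omega) le_rfl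
      · intro j hj
        rw [Finset.mem_Ioc] at hj
        rw [if_pos (hF j _ hj.1 hj.2 hf)]
    · rw [sum_Ioc_succ _ hN, if_neg hf, add_zero]
      exact ih fun t h1 h2 => h t h1 (by omega)

lemma sum_final_nonneg (d : ℕ → ℤ) (F : ℕ → Prop) [DecidablePred F] {s N : ℕ} (hsN : s ≤ N)
    (hF : ∀ t u, t ≤ u → u ≤ N → F t → F u)
    (h : ∀ t, s ≤ t → t ≤ N → 0 ≤ ∑ j ∈ Finset.Ioc t N, d j) :
    0 ≤ ∑ j ∈ Finset.Ioc s N, if F j then d j else 0 := by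
  induction hsN using Nat.decreasingInduction with
  | self => simp
  | of_succ s hs ih =>
    by_cases hf : F (s + 1)
    · rw [Finset.sum_congr rfl (g := d)]
      · exact h s le_rfl (by omega)
      · intro j hj
        rw [Finset.mem_Ioc] at hj
        rw [if_pos (hF _ _ hj.1 hj.2 hf)]
    · rw [sum_Ioc_add _ (Nat.le_succ s) hs]
      have : ∑ j ∈ Finset.Ioc s s.succ, (if F j then d j else 0) = 0 := by simp [hf]
      rw [this, zero_add]
      exact ih fun t h1 h2 => h t (by omega) h2

lemma score_congr {w w' : ℕ → ℕ} {s N : ℕ} (h : ∀ j, s < j → j ≤ N → w j = w' j)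
    (g : ℕ → ℕ → ℤ) : score w s N g = score w' s N g := by
  unfold score
  apply Finset.sum_congr rfl
  intro j hj
  rw [Finset.mem_Ioc] at hj
  rw [h j hj.1 hj.2]

lemma Reach.raise {n N q x s : ℕ} {m K : ℤ} {w : ℕ → ℕ} (hx : 1 ≤ x) (hxn : x < n) (hqN : q ≤ N)
    (hwq : w q = x + 1) (hafter : ∀ t, q ≤ t → t ≤ N → cnt w q t (x + 1) ≤ cnt w q t x)
    (h : Reach n m w s N K) : Reach n m (Function.update w q x) s N K := by
  obtain ⟨g, hg, hK⟩ := h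
  by_cases hsq : q ≤ s
  · refine ⟨g, hg, hK.trans_eq (score_congr (fun j h1 h2 => ?_) g)⟩
    rw [Function.update_of_ne (show j ≠ q by omega)]
  push Not at hsq
  let P : ℕ → Prop := fun t => g t (x + 1) = g t x ∧ g t (x + 2) = g t (x + 1) + 1
  by_cases hP : P q
  swap
  · refine ⟨g, hg, hK.trans (Finset.sum_le_sum fun t _ => ?_)⟩
    by_cases htq : t = q
    · subst htq
      rw [Function.update_self, hwq]
      have h1 := hg.le_succ t x
      have h2 := hg.succ_le t x
      have h3 := hg.le_succ t (x + 1)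
      have h4 := hg.succ_le t (x + 1)
      simp only [P, show x + 1 + 1 = x + 2 from rfl] at *
      omega
    · rw [Function.update_of_ne htq]
  classical
  let F : ℕ → Prop := fun t => q ≤ t ∧ ∀ u, q ≤ u → u ≤ t → P u
  have hFP : ∀ t, F t → P t := fun t ht => ht.2 t ht.1 le_rfl
  let g' : ℕ → ℕ → ℤ := fun t y => g t y + if F t ∧ y = x + 1 then 1 else 0
  have hFs : ∀ t, F t → P (t + 1) → F (t + 1) := by
    refine fun t ht hp => ⟨by have := ht.1; omega, fun u h1 h2 => ?_⟩
    rcases Nat.lt_or_ge t u with h3 | h3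
    · obtain rfl : u = t + 1 := by omega
      exact hp
    · exact ht.2 u h1 h3
  refine ⟨g', ⟨fun t => ?_, fun t => ?_, fun t y => ?_, fun t y => ?_, fun t y => ?_⟩, ?_⟩
  · simp only [g', show ¬ (1 = x + 1) by omega, and_false, if_false, add_zero, hg.bot]
  · simp only [g', show ¬ (n + 1 = x + 1) by omega, and_false, if_false, add_zero, hg.top]
  · by_cases hF : F t
    · have h2 := hFP t hF
      have h1 := hg.le_succ t y
      simp only [P] at h2
      simp only [g', hF, true_and]
      by_cases hy : y = x + 1
      · subst hy
        simp only [show x + 1 + 1 = x + 2 from rfl, show ¬ (x + 2 = x + 1) by omega, if_true,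
          if_false]
        omega
      · split_ifs <;> omega
    · simp only [g', hF, false_and, if_false, add_zero]; exact hg.le_succ t y
  · by_cases hF : F t
    · have h2 := hFP t hF
      have h1 := hg.succ_le t y
      simp only [P] at h2
      simp only [g', hF, true_and]
      by_cases hy : y = x
      · subst hy; simp; omega
      · rw [if_neg (show ¬ (y + 1 = x + 1) by omega)]; split_ifs <;> omega
    · simp only [g', hF, false_and, if_false, add_zero]; exact hg.succ_le t y
  · have h1 := hg.mono t y
    by_cases hF : F t
    · by_cases hF1 : F (t + 1)
      · simp only [g', hF, hF1, true_and]; omega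
      · have h2 := hFP t hF
        have h3 : ¬ P (t + 1) := fun hp => hF1 (hFs t hF hp)
        simp only [g', hF, hF1, true_and, false_and, if_false, add_zero]
        split_ifs with hy
        · subst hy
          have a1 := hg.mono t x
          have a2 := hg.mono t (x + 2)
          have a3 := hg.le_succ (t + 1) x
          have a4 := hg.succ_le (t + 1) x
          have a5 := hg.le_succ (t + 1) (x + 1)
          have a6 := hg.succ_le (t + 1) (x + 1)
          simp only [P, show x + 1 + 1 = x + 2 from rfl] at *
          omega
        · omega
    · simp only [g', hF, false_and, if_false]
      split_ifs <;> omega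
  · let d : ℕ → ℤ := fun t => (if w t = x then 1 else 0) - if w t = x + 1 then 1 else 0
    have hpt : ∀ t, g' t (Function.update w q x t + 1) - g' t (Function.update w q x t) =
        (g t (w t + 1) - g t (w t)) + if q < t ∧ F t then d t else 0 := by
      intro t
      by_cases htq : t = q
      · subst htq
        have hF : F t := ⟨le_rfl, fun u h1 h2 => by
          obtain rfl : u = t := by omega
          exact hP⟩
        rw [Function.update_self, hwq]
        simp only [P, show x + 1 + 1 = x + 2 from rfl] at *
        simp [g', hF]; omega
      · rw [Function.update_of_ne htq]
        by_cases hF : F t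
        · have h0 : q < t := by have := hF.1; omega
          simp only [g', d, hF, h0, true_and, if_true]
          split_ifs <;> omega
        · simp [g', hF]
    have h0 : 0 ≤ ∑ t ∈ Finset.Ioc q N, if F t then d t else 0 := by
      refine sum_initial_nonneg d F hqN
        (fun t u h1 h2 h3 => ⟨h1.le, fun v hv hv' => h3.2 v hv (by omega)⟩) (fun t h1 h2 => ?_)
      simp only [d]
      rw [Finset.sum_sub_distrib, ← cnt_eq_sum, ← cnt_eq_sum]
      have := hafter t h1 h2
      omega
    unfold score at hK ⊢
    simp only [hpt]
    rw [Finset.sum_add_distrib, sum_Ioc_add (fun t => if q < t ∧ F t then d t else 0) hsq.le hqN]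
    have e1 : ∑ t ∈ Finset.Ioc s q, (if q < t ∧ F t then d t else 0) = 0 := by
      refine Finset.sum_eq_zero fun t ht => ?_
      rw [Finset.mem_Ioc] at ht
      rw [if_neg (by omega)]
    have e2 : ∑ t ∈ Finset.Ioc q N, (if q < t ∧ F t then d t else 0) =
        ∑ t ∈ Finset.Ioc q N, if F t then d t else 0 := by
      refine Finset.sum_congr rfl fun t ht => ?_
      rw [Finset.mem_Ioc] at ht
      simp [ht.1]
    rw [e1, e2]; omega

lemma Reach.of_raise {n N q x s : ℕ} {m K : ℤ} {w : ℕ → ℕ} (hx : 1 ≤ x) (hxn : x < n)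
    (hqN : q ≤ N) (hwq : w q = x + 1)
    (hbefore : ∀ t, s ≤ t → t < q → cnt w t (q - 1) x ≤ cnt w t (q - 1) (x + 1))
    (h : Reach n m (Function.update w q x) s N K) : Reach n m w s N K := by
  obtain ⟨g, hg, hK⟩ := h
  by_cases hsq : q ≤ s
  · refine ⟨g, hg, hK.trans_eq (score_congr (fun j h1 h2 => ?_) g)⟩
    rw [Function.update_of_ne (show j ≠ q by omega)]
  push Not at hsq
  let P : ℕ → Prop := fun t => g t (x + 1) = g t x + 1 ∧ g t (x + 2) = g t (x + 1)
  by_cases hP : P q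
  swap
  · refine ⟨g, hg, hK.trans (Finset.sum_le_sum fun t _ => ?_)⟩
    by_cases htq : t = q
    · subst htq
      rw [Function.update_self, hwq]
      have h1 := hg.le_succ t x
      have h2 := hg.succ_le t x
      have h3 := hg.le_succ t (x + 1)
      have h4 := hg.succ_le t (x + 1)
      simp only [P, show x + 1 + 1 = x + 2 from rfl] at *
      omega
    · rw [Function.update_of_ne htq]
  classical
  let F : ℕ → Prop := fun t => t ≤ q ∧ ∀ u, t ≤ u → u ≤ q → P u
  have hFP : ∀ t, F t → P t := fun t ht => ht.2 t le_rfl ht.1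
  let g' : ℕ → ℕ → ℤ := fun t y => g t y - if F t ∧ y = x + 1 then 1 else 0
  have hFs : ∀ t, F (t + 1) → P t → F t := by
    refine fun t ht hp => ⟨by have := ht.1; omega, fun u h1 h2 => ?_⟩
    rcases Nat.lt_or_ge t u with h3 | h3
    · exact ht.2 u h3 h2
    · obtain rfl : u = t := by omega
      exact hp
  refine ⟨g', ⟨fun t => ?_, fun t => ?_, fun t y => ?_, fun t y => ?_, fun t y => ?_⟩, ?_⟩
  · simp only [g', show ¬ (1 = x + 1) by omega, and_false, if_false, sub_zero, hg.bot]
  · simp only [g', show ¬ (n + 1 = x + 1) by omega, and_false, if_false, sub_zero, hg.top]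
  · by_cases hF : F t
    · have h2 := hFP t hF
      have h1 := hg.le_succ t y
      simp only [P] at h2
      simp only [g', hF, true_and]
      by_cases hy : y = x
      · subst hy; simp; omega
      · rw [if_neg (show ¬ (y + 1 = x + 1) by omega)]; split_ifs <;> omega
    · simp only [g', hF, false_and, if_false, sub_zero]; exact hg.le_succ t y
  · by_cases hF : F t
    · have h2 := hFP t hF
      have h1 := hg.succ_le t y
      simp only [P] at h2
      simp only [g', hF, true_and]
      by_cases hy : y = x + 1
      · subst hy
        simp only [show x + 1 + 1 = x + 2 from rfl, show ¬ (x + 2 = x + 1) by omega, if_true,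
          if_false]
        omega
      · split_ifs <;> omega
    · simp only [g', hF, false_and, if_false, sub_zero]; exact hg.succ_le t y
  · have h1 := hg.mono t y
    by_cases hF1 : F (t + 1)
    · by_cases hF : F t
      · simp only [g', hF, hF1, true_and]; omega
      · have h2 := hFP _ hF1
        have h3 : ¬ P t := fun hp => hF (hFs t hF1 hp)
        simp only [g', hF, hF1, true_and, false_and, if_false, sub_zero]
        split_ifs with hy
        · subst hy
          have a1 := hg.mono t x
          have a2 := hg.mono t (x + 2)
          have a3 := hg.le_succ t x
          have a4 := hg.succ_le t x
          have a5 := hg.le_succ t (x + 1)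
          have a6 := hg.succ_le t (x + 1)
          simp only [P, show x + 1 + 1 = x + 2 from rfl] at *
          omega
        · omega
    · simp only [g', hF1, false_and, if_false]
      split_ifs <;> omega
  · let d : ℕ → ℤ := fun t => (if w t = x + 1 then 1 else 0) - if w t = x then 1 else 0
    have hpt : ∀ t, g' t (w t + 1) - g' t (w t) =
        (g t (Function.update w q x t + 1) - g t (Function.update w q x t)) +
          if t < q ∧ F t then d t else 0 := by
      intro t
      by_cases htq : t = q
      · subst htq
        have hF : F t := ⟨le_rfl, fun u h1 h2 => by
          obtain rfl : u = t := by omega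
          exact hP⟩
        rw [Function.update_self, hwq]
        simp only [P, show x + 1 + 1 = x + 2 from rfl] at *
        simp [g', hF]; omega
      · rw [Function.update_of_ne htq]
        by_cases hF : F t
        · have h0 : t < q := by have := hF.1; omega
          simp only [g', d, hF, h0, true_and, if_true]
          split_ifs <;> omega
        · simp [g', hF]
    have h0 : 0 ≤ ∑ t ∈ Finset.Ioc s (q - 1), if F t then d t else 0 := by
      refine sum_final_nonneg d F (by omega)
        (fun t u h1 h2 h3 => ⟨by omega, fun v hv hv' => h3.2 v (by omega) hv'⟩)
        (fun t h1 h2 => ?_)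
      simp only [d]
      rw [Finset.sum_sub_distrib, ← cnt_eq_sum, ← cnt_eq_sum]
      have := hbefore t h1 (by omega)
      omega
    unfold score at hK ⊢
    simp only [hpt]
    rw [Finset.sum_add_distrib,
      sum_Ioc_add (fun t => if t < q ∧ F t then d t else 0) (show s ≤ q - 1 by omega)
        (show q - 1 ≤ N by omega)]
    have e1 : ∑ t ∈ Finset.Ioc (q - 1) N, (if t < q ∧ F t then d t else 0) = 0 := by
      refine Finset.sum_eq_zero fun t ht => ?_
      rw [Finset.mem_Ioc] at ht
      rw [if_neg (by omega)]
    have e2 : ∑ t ∈ Finset.Ioc s (q - 1), (if t < q ∧ F t then d t else 0) =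
        ∑ t ∈ Finset.Ioc s (q - 1), if F t then d t else 0 := by
      refine Finset.sum_congr rfl fun t ht => ?_
      rw [Finset.mem_Ioc] at ht
      simp [show t < q by omega]
    rw [e1, e2]; omega

lemma abel_antitone (c h : ℕ → ℤ) (n : ℕ) (hc : ∀ y, 1 ≤ y → y < n → c (y + 1) ≤ c y)
    (hh : ∀ y, 0 ≤ h y) (h1 : h 1 = 0) :
    c n * h (n + 1) ≤ ∑ y ∈ Finset.Ioc 0 n, c y * (h (y + 1) - h y) ∨ n = 0 := by
  induction n with
  | zero => exact Or.inr rfl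
  | succ n ih =>
    left
    rw [sum_Ioc_succ _ (Nat.zero_le n)]
    rcases ih fun y a b => hc y a (by omega) with h2 | rfl
    · rcases Nat.eq_zero_or_pos n with rfl | hn
      · simp [h1]
      · nlinarith [hc n hn (by omega), hh (n + 1)]
    · simp [h1]

lemma abel_monotone (c h : ℕ → ℤ) (n : ℕ) (hc : ∀ y, 1 ≤ y → y < n → c y ≤ c (y + 1))
    (hh : ∀ y, 0 ≤ h y) (h1 : h 1 = 0) :
    ∑ y ∈ Finset.Ioc 0 n, c y * (h (y + 1) - h y) ≤ c n * h (n + 1) ∨ n = 0 := by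
  have := abel_antitone (fun y => - c y) h n (fun y a b => neg_le_neg (hc y a b)) hh h1
  simpa only [neg_mul, Finset.sum_neg_distrib, neg_le_neg_iff] using this

lemma abel_antitone_nonneg (c h : ℕ → ℤ) (n : ℕ) (hc : ∀ y, 1 ≤ y → y < n → c (y + 1) ≤ c y)
    (hh : ∀ y, 0 ≤ h y) (h1 : h 1 = 0) (hn : h (n + 1) = 0) :
    0 ≤ ∑ y ∈ Finset.Ioc 0 n, c y * (h (y + 1) - h y) := by
  rcases abel_antitone c h n hc hh h1 with h2 | rfl
  · simpa [hn] using h2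
  · simp

lemma abel_monotone_nonpos (c h : ℕ → ℤ) (n : ℕ) (hc : ∀ y, 1 ≤ y → y < n → c y ≤ c (y + 1))
    (hh : ∀ y, 0 ≤ h y) (h1 : h 1 = 0) (hn : h (n + 1) = 0) :
    ∑ y ∈ Finset.Ioc 0 n, c y * (h (y + 1) - h y) ≤ 0 := by
  rcases abel_monotone c h n hc hh h1 with h2 | rfl
  · simpa [hn] using h2
  · simp

lemma IsFamily.nonneg {n : ℕ} {m : ℤ} {g : ℕ → ℕ → ℤ} (hg : IsFamily n m g) (t y : ℕ)
    (hy : 1 ≤ y) : 0 ≤ g t y := by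
  induction y, hy using Nat.le_induction with
  | base => exact (hg.bot t).ge
  | succ y _ ih => exact ih.trans (hg.le_succ t y)

lemma IsFamily.le_pred {n : ℕ} {m : ℤ} {g : ℕ → ℕ → ℤ} (hg : IsFamily n m g) (t y : ℕ)
    (hy : 1 ≤ y) : g t y ≤ y - 1 := by
  induction y, hy using Nat.le_induction with
  | base => simp [hg.bot t]
  | succ y _ ih => have := hg.succ_le t y; push_cast; omega

lemma IsFamily.le_top {n : ℕ} {m : ℤ} {g : ℕ → ℕ → ℤ} (hg : IsFamily n m g) (t y : ℕ)
    (hy : y ≤ n + 1) : g t y ≤ m := by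
  induction hy using Nat.decreasingInduction with
  | self => exact (hg.top t).le
  | of_succ y _ ih => exact (hg.le_succ t y).trans ih

lemma IsFamily.ge_top {n : ℕ} {m : ℤ} {g : ℕ → ℕ → ℤ} (hg : IsFamily n m g) (t y : ℕ)
    (hy : y ≤ n + 1) : m - (n + 1 - y) ≤ g t y := by
  induction hy using Nat.decreasingInduction with
  | self => simp [hg.top t]
  | of_succ y _ ih => have := hg.succ_le t y; push_cast at *; omega

/-- The counting function of the set `{1, …, m}`. -/
def lowCount (m : ℤ) (y : ℕ) : ℤ := min ((y : ℤ) - 1) m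

/-- The counting function of the set `{n - m + 1, …, n}`. -/
def highCount (n : ℕ) (m : ℤ) (y : ℕ) : ℤ := max 0 (m - (n + 1 - y))

lemma isFamily_lowCount {n : ℕ} {m : ℤ} (h0 : 0 ≤ m) (hm : m ≤ n) :
    IsFamily n m (fun _ => lowCount m) := by
  constructor <;> intros <;> simp only [lowCount] <;> push_cast <;> omega

lemma isFamily_highCount {n : ℕ} {m : ℤ} (h0 : 0 ≤ m) (hm : m ≤ n) :
    IsFamily n m (fun _ => highCount n m) := by
  constructor <;> intros <;> simp only [highCount] <;> push_cast <;> omega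

lemma sum_letter {n : ℕ} (f : ℕ → ℤ) {a : ℕ} (h1 : 1 ≤ a) (h2 : a ≤ n) :
    ∑ y ∈ Finset.Ioc 0 n, (if a = y then 1 else 0) * f y = f a := by
  simp [Finset.sum_ite_eq, show 0 < a by omega, h2]

lemma score_const {n s N : ℕ} {w : ℕ → ℕ} (hsN : s ≤ N)
    (hw : ∀ j, s < j → j ≤ N → 1 ≤ w j ∧ w j ≤ n) (g : ℕ → ℤ) :
    score w s N (fun _ => g) = ∑ y ∈ Finset.Ioc 0 n, (cnt w s N y : ℤ) * (g (y + 1) - g y) := by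
  induction N, hsN using Nat.le_induction with
  | base => simp [score, cnt_self]
  | succ N hN ih =>
    unfold score at ih ⊢
    rw [sum_Ioc_succ _ hN, ih fun j a b => hw j a (by omega)]
    simp only [cnt_succ w hN]
    push_cast
    simp only [add_mul, Finset.sum_add_distrib]
    rw [sum_letter (fun y => g (y + 1) - g y) (hw (N + 1) (by omega) le_rfl).1
      (hw (N + 1) (by omega) le_rfl).2]

lemma score_le_of_antitone {n s N : ℕ} {m : ℤ} {w : ℕ → ℕ} {g : ℕ → ℕ → ℤ} (hsN : s ≤ N)
    (hw : ∀ j, s < j → j ≤ N → 1 ≤ w j ∧ w j ≤ n)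
    (hyam : ∀ t, s ≤ t → t ≤ N → ∀ y, 1 ≤ y → y < n → cnt w s t (y + 1) ≤ cnt w s t y)
    (hg : IsFamily n m g) :
    score w s N g ≤ ∑ y ∈ Finset.Ioc 0 n, (cnt w s N y : ℤ) * (g N (y + 1) - g N y) := by
  induction N, hsN using Nat.le_induction with
  | base => simp [score, cnt_self]
  | succ N hN ih =>
    have ih := ih (fun j a b => hw j a (by omega)) fun t a b => hyam t a (by omega)
    unfold score at ih ⊢
    rw [sum_Ioc_succ _ hN]
    simp only [cnt_succ w hN]
    push_cast
    simp only [add_mul, Finset.sum_add_distrib]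
    rw [sum_letter (fun y => g (N + 1) (y + 1) - g (N + 1) y) (hw (N + 1) (by omega) le_rfl).1
      (hw (N + 1) (by omega) le_rfl).2]
    have := abel_antitone_nonneg (fun y => cnt w s N y) (fun y => g (N + 1) y - g N y) n
      (fun y a b => by exact_mod_cast hyam N hN (by omega) y a b)
      (fun y => sub_nonneg.2 (hg.mono N y)) (by simp [hg.bot]) (by simp [hg.top])
    have e : ∑ y ∈ Finset.Ioc 0 n, (cnt w s N y : ℤ) * (g (N + 1) (y + 1) - g (N + 1) y) =
        ∑ y ∈ Finset.Ioc 0 n, (cnt w s N y : ℤ) * (g N (y + 1) - g N y) +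
        ∑ y ∈ Finset.Ioc 0 n,
          (cnt w s N y : ℤ) * (g (N + 1) (y + 1) - g N (y + 1) - (g (N + 1) y - g N y)) := by
      rw [← Finset.sum_add_distrib]
      exact Finset.sum_congr rfl fun y _ => by ring
    linarith

lemma score_le_of_monotone {n s N : ℕ} {m : ℤ} {w : ℕ → ℕ} {g : ℕ → ℕ → ℤ} (hsN : s ≤ N)
    (hw : ∀ j, s < j → j ≤ N → 1 ≤ w j ∧ w j ≤ n)
    (hyam : ∀ t, s ≤ t → t ≤ N → ∀ y, 1 ≤ y → y < n → cnt w t N y ≤ cnt w t N (y + 1))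
    (hg : IsFamily n m g) :
    score w s N g ≤
      ∑ y ∈ Finset.Ioc 0 n, (cnt w s N y : ℤ) * (g (s + 1) (y + 1) - g (s + 1) y) := by
  induction hsN using Nat.decreasingInduction with
  | self => simp [score, cnt_self]
  | of_succ s hs ih =>
    have ih := ih (fun j a b => hw j (by omega) b) fun t a b => hyam t (by omega) b
    unfold score at ih ⊢
    rw [sum_Ioc_add _ (Nat.le_succ s) hs, Nat.succ_eq_add_one, sum_Ioc_succ _ le_rfl,
      Finset.Ioc_self, Finset.sum_empty, zero_add]
    simp only [cnt_head w (show s < N from hs)]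
    push_cast
    simp only [add_mul, Finset.sum_add_distrib]
    rw [sum_letter (fun y => g (s + 1) (y + 1) - g (s + 1) y) (hw (s + 1) (by omega) hs).1
      (hw (s + 1) (by omega) hs).2]
    have := abel_monotone_nonpos (fun y => cnt w (s + 1) N y)
      (fun y => g (s + 1 + 1) y - g (s + 1) y) n
      (fun y a b => by exact_mod_cast hyam (s + 1) (by omega) hs y a b)
      (fun y => sub_nonneg.2 (hg.mono (s + 1) y)) (by simp [hg.bot]) (by simp [hg.top])
    have e : ∑ y ∈ Finset.Ioc 0 n,
          (cnt w (s + 1) N y : ℤ) * (g (s + 1 + 1) (y + 1) - g (s + 1 + 1) y) =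
        ∑ y ∈ Finset.Ioc 0 n, (cnt w (s + 1) N y : ℤ) * (g (s + 1) (y + 1) - g (s + 1) y) +
        ∑ y ∈ Finset.Ioc 0 n, (cnt w (s + 1) N y : ℤ) *
          (g (s + 1 + 1) (y + 1) - g (s + 1) (y + 1) - (g (s + 1 + 1) y - g (s + 1) y)) := by
      rw [← Finset.sum_add_distrib]
      exact Finset.sum_congr rfl fun y _ => by ring
    linarith

lemma reach_iff_of_antitone {n s N : ℕ} {m K : ℤ} {w : ℕ → ℕ} (hsN : s ≤ N) (h0 : 0 ≤ m)
    (hm : m ≤ n) (hw : ∀ j, s < j → j ≤ N → 1 ≤ w j ∧ w j ≤ n)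
    (hyam : ∀ t, s ≤ t → t ≤ N → ∀ y, 1 ≤ y → y < n → cnt w s t (y + 1) ≤ cnt w s t y) :
    Reach n m w s N K ↔
      K ≤ ∑ y ∈ Finset.Ioc 0 n, (cnt w s N y : ℤ) * (lowCount m (y + 1) - lowCount m y) := by
  constructor
  · rintro ⟨g, hg, hK⟩
    refine hK.trans ((score_le_of_antitone hsN hw hyam hg).trans ?_)
    have := abel_antitone_nonneg (fun y => cnt w s N y)
      (fun y => if 1 ≤ y ∧ y ≤ n + 1 then lowCount m y - g N y else 0) n
      (fun y a b => by exact_mod_cast hyam N hsN le_rfl y a b)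
      (fun y => by
        split_ifs with h
        · have a := hg.le_pred N y h.1
          have b := hg.le_top N y h.2
          simp only [lowCount]; omega
        · exact le_rfl) (by simp [lowCount, hg.bot, h0]) (by simp [lowCount, hg.top, hm])
    have e : ∑ y ∈ Finset.Ioc 0 n, (cnt w s N y : ℤ) * (lowCount m (y + 1) - lowCount m y) =
        ∑ y ∈ Finset.Ioc 0 n, (cnt w s N y : ℤ) * (g N (y + 1) - g N y) +
        ∑ y ∈ Finset.Ioc 0 n, (cnt w s N y : ℤ) *
          ((if 1 ≤ y + 1 ∧ y + 1 ≤ n + 1 then lowCount m (y + 1) - g N (y + 1) else 0) -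
            if 1 ≤ y ∧ y ≤ n + 1 then lowCount m y - g N y else 0) := by
      rw [← Finset.sum_add_distrib]
      refine Finset.sum_congr rfl fun y hy => ?_
      rw [Finset.mem_Ioc] at hy
      rw [if_pos (by omega), if_pos (by omega)]
      ring
    linarith
  · exact fun h => ⟨_, isFamily_lowCount h0 hm, h.trans_eq (score_const hsN hw _).symm⟩

lemma reach_iff_of_monotone {n s N : ℕ} {m K : ℤ} {w : ℕ → ℕ} (hsN : s ≤ N) (h0 : 0 ≤ m)
    (hm : m ≤ n) (hw : ∀ j, s < j → j ≤ N → 1 ≤ w j ∧ w j ≤ n)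
    (hyam : ∀ t, s ≤ t → t ≤ N → ∀ y, 1 ≤ y → y < n → cnt w t N y ≤ cnt w t N (y + 1)) :
    Reach n m w s N K ↔
      K ≤ ∑ y ∈ Finset.Ioc 0 n,
        (cnt w s N y : ℤ) * (highCount n m (y + 1) - highCount n m y) := by
  constructor
  · rintro ⟨g, hg, hK⟩
    refine hK.trans ((score_le_of_monotone hsN hw hyam hg).trans ?_)
    have := abel_monotone_nonpos (fun y => cnt w s N y)
      (fun y => if 1 ≤ y ∧ y ≤ n + 1 then g (s + 1) y - highCount n m y else 0) n
      (fun y a b => by exact_mod_cast hyam s le_rfl hsN y a b)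
      (fun y => by
        split_ifs with h
        · have a := hg.nonneg (s + 1) y h.1
          have b := hg.ge_top (s + 1) y h.2
          simp only [highCount]; omega
        · exact le_rfl) (by simp [highCount, hg.bot, hm]) (by simp [highCount, hg.top, h0])
    have e : ∑ y ∈ Finset.Ioc 0 n, (cnt w s N y : ℤ) * (g (s + 1) (y + 1) - g (s + 1) y) =
        ∑ y ∈ Finset.Ioc 0 n, (cnt w s N y : ℤ) * (highCount n m (y + 1) - highCount n m y) +
        ∑ y ∈ Finset.Ioc 0 n, (cnt w s N y : ℤ) *
          ((if 1 ≤ y + 1 ∧ y + 1 ≤ n + 1 then g (s + 1) (y + 1) - highCount n m (y + 1) else 0) -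
            if 1 ≤ y ∧ y ≤ n + 1 then g (s + 1) y - highCount n m y else 0) := by
      rw [← Finset.sum_add_distrib]
      refine Finset.sum_congr rfl fun y hy => ?_
      rw [Finset.mem_Ioc] at hy
      rw [if_pos (by omega), if_pos (by omega)]
      ring
    linarith
  · exact fun h => ⟨_, isFamily_highCount h0 hm, h.trans_eq (score_const hsN hw _).symm⟩

/-- A Yamanouchi word and a word that is Yamanouchi when read backwards with complemented letters
have reversed contents if they are equivalent with respect to `Reach`. -/
lemma cnt_eq_cnt_reverse {n s N : ℕ} {v w : ℕ → ℕ} (hsN : s ≤ N)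
    (hv : ∀ j, s < j → j ≤ N → 1 ≤ v j ∧ v j ≤ n)
    (hvyam : ∀ t, s ≤ t → t ≤ N → ∀ y, 1 ≤ y → y < n → cnt v s t (y + 1) ≤ cnt v s t y)
    (hw : ∀ j, s < j → j ≤ N → 1 ≤ w j ∧ w j ≤ n)
    (hwyam : ∀ t, s ≤ t → t ≤ N → ∀ y, 1 ≤ y → y < n → cnt w t N y ≤ cnt w t N (y + 1))
    (hvw : ∀ m K : ℤ, Reach n m v s N K ↔ Reach n m w s N K) {y : ℕ} (hy : 1 ≤ y) (hyn : y ≤ n) :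
    cnt v s N y = cnt w s N (n + 1 - y) := by
  have key : ∀ m : ℤ, 0 ≤ m → m ≤ n →
      ∑ y ∈ Finset.Ioc 0 n, (cnt v s N y : ℤ) * (lowCount m (y + 1) - lowCount m y) =
      ∑ y ∈ Finset.Ioc 0 n, (cnt w s N y : ℤ) * (highCount n m (y + 1) - highCount n m y) := by
    intro m h0 hm
    refine eq_of_forall_le_iff fun K => ?_
    rw [← reach_iff_of_antitone hsN h0 hm hv hvyam, ← reach_iff_of_monotone hsN h0 hm hw hwyam,
      hvw]
  have k1 := key y (by omega) (by omega)
  have k2 := key (y - 1) (by omega) (by omega)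
  have e1 : ∑ z ∈ Finset.Ioc 0 n, (cnt v s N z : ℤ) * (lowCount y (z + 1) - lowCount y z) =
      ∑ z ∈ Finset.Ioc 0 n, (cnt v s N z : ℤ) * (lowCount (y - 1) (z + 1) - lowCount (y - 1) z)
        + cnt v s N y := by
    rw [← sum_letter (fun z => (cnt v s N z : ℤ)) hy hyn, ← Finset.sum_add_distrib]
    refine Finset.sum_congr rfl fun z _ => ?_
    have : lowCount y (z + 1) - lowCount y z =
        lowCount (y - 1) (z + 1) - lowCount (y - 1) z + if y = z then 1 else 0 := by
      simp only [lowCount]; push_cast; split_ifs <;> omega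
    rw [this]; ring
  have e2 : ∑ z ∈ Finset.Ioc 0 n,
        (cnt w s N z : ℤ) * (highCount n y (z + 1) - highCount n y z) =
      ∑ z ∈ Finset.Ioc 0 n,
        (cnt w s N z : ℤ) * (highCount n (y - 1) (z + 1) - highCount n (y - 1) z)
        + cnt w s N (n + 1 - y) := by
    rw [← sum_letter (fun z => (cnt w s N z : ℤ)) (show 1 ≤ n + 1 - y by omega)
      (show n + 1 - y ≤ n by omega), ← Finset.sum_add_distrib]
    refine Finset.sum_congr rfl fun z _ => ?_
    have : highCount n y (z + 1) - highCount n y z =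
        highCount n (y - 1) (z + 1) - highCount n (y - 1) z +
          if n + 1 - y = z then 1 else 0 := by
      simp only [highCount]; push_cast; split_ifs <;> omega
    rw [this]; ring
  omega

lemma cnt_lt (w : ℕ → ℕ) {s t q y : ℕ} (h : s ≤ t) (hq : t < q) (hw : w q = y) :
    cnt w s t y < cnt w s q y := by
  have h1 := cnt_pred w (show s < q by omega) y
  have h2 := cnt_mono w h (show t ≤ q - 1 by omega) y
  rw [if_pos hw] at h1
  omega

/-- The state of a slide with the empty cell at `(r, c)`. The entries `s + 1, …, N` of `f` are
given by the word `w` of their rows, `τ` is the entry that left the empty cell, `C` is the shape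
that consists of the positive cells and the empty cell, and outside of it `f` agrees with `old`. -/
structure SlideState (n k N s : ℕ) (C : ℕ → ℕ) (old : Filling) (w : ℕ → ℕ) (f : Filling)
    (r c τ : ℕ) : Prop where
  letters : ∀ j, s < j → j ≤ N → 1 ≤ w j ∧ w j ≤ n
  row_pos : 1 ≤ r
  row_le : r ≤ n
  col_pos : 1 ≤ c
  col_le : c ≤ C r
  content : ∀ y, cnt w s N y + (if y = r then 1 else 0) = C y
  above : ∀ y t, s ≤ t → t ≤ N → 1 ≤ y → y + 1 = r →
    cnt w s t r + (if τ ≤ t then 1 else 0) ≤ cnt w s t y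
  below : ∀ t, s ≤ t → t ≤ N → cnt w s t (r + 1) ≤ cnt w s t r + if τ ≤ t then 1 else 0
  other : ∀ y t, s ≤ t → t ≤ N → 1 ≤ y → y ≠ r → cnt w s t (y + 1) ≤ cnt w s t y
  left : ∀ t, s ≤ t → t ≤ N → cnt w s t r + 1 < c → cnt w s t (r + 1) ≤ cnt w s t r
  entry : ∀ j, s < j → j ≤ N → (w j = r → cnt w s j r < c) → f (w j, cnt w s j (w j)) = j
  entry_right : ∀ j, s < j → j ≤ N → w j = r → c ≤ cnt w s j r → f (r, cnt w s j r + 1) = j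
  rest : ∀ y c', 1 ≤ y → y ≤ n → C y < c' → c' ≤ k → f (y, c') = old (y, c')

section Slide

variable {n k N s : ℕ} {C : ℕ → ℕ} {old : Filling} {w : ℕ → ℕ} {f : Filling} {r c τ : ℕ}

lemma SlideState.right (h : SlideState n k N s C old w f r c τ) {j : ℕ} (hj : s < j) (hjN : j ≤ N)
    (hw : w j = r) (hc : cnt w s j r = c)
    (hlow : ∀ t, s ≤ t → t ≤ N → cnt w s t r < c → cnt w s t (r + 1) ≤ cnt w s t r) :
    SlideState n k N s C old w (Function.update f (r, c) (j : ℤ)) r (c + 1) τ where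
  letters := h.letters
  row_pos := h.row_pos
  row_le := h.row_le
  col_pos := by omega
  col_le := by
    have h1 := h.content r
    have h2 := cnt_mono w hj.le hjN r
    rw [if_pos rfl] at h1
    omega
  content := h.content
  above := h.above
  below := h.below
  other := h.other
  left := fun t h1 h2 h3 => hlow t h1 h2 (by omega)
  entry := by
    intro i hi hiN hlt
    by_cases hwi : w i = r
    · have h1 := hlt hwi
      by_cases hij : i = j
      · subst hij; rw [hw, hc]; simp
      · have h2 : cnt w s i r ≠ c := by
          rcases Nat.lt_or_gt_of_ne hij with h3 | h3
          · have := cnt_lt w hi.le h3 hw; omega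
          · have := cnt_lt w hj.le h3 hwi; omega
        rw [Function.update_of_ne (by simp [hwi, h2])]
        exact h.entry i hi hiN fun _ => by omega
    · rw [Function.update_of_ne (by simp [hwi])]
      exact h.entry i hi hiN fun h1 => absurd h1 hwi
  entry_right := by
    intro i hi hiN hwi h1
    rw [Function.update_of_ne (by simp; omega)]
    exact h.entry_right i hi hiN hwi (by omega)
  rest := by
    intro y c' h1 h2 h3 h4
    rw [Function.update_of_ne]
    · exact h.rest y c' h1 h2 h3 h4
    · rintro h5
      obtain ⟨rfl, rfl⟩ := Prod.mk.inj h5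
      have := h.col_le
      omega

lemma SlideState.cnt_row (h : SlideState n k N s C old w f r c τ) {q : ℕ} (hq : s < q)
    (hqN : q ≤ N) (hc : cnt w s q (r + 1) = c) (hr : cnt w s q r < c) : cnt w s q r + 1 = c := by
  have := h.below q hq.le hqN
  split_ifs at this <;> omega

lemma SlideState.le_of_lt_down (h : SlideState n k N s C old w f r c τ) {q : ℕ} (hqN : q ≤ N)
    (hw : w q = r + 1) (hc : cnt w s q (r + 1) = c) {t : ℕ} (hst : s ≤ t) (htq : t < q) :
    cnt w s t (r + 1) ≤ cnt w s t r := by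
  by_cases h1 : cnt w s t r + 1 < c
  · exact h.left t hst (by omega) h1
  · have := cnt_lt w hst htq hw
    omega

lemma SlideState.time_le (h : SlideState n k N s C old w f r c τ) {q : ℕ} (hq : s < q)
    (hqN : q ≤ N) (hc : cnt w s q (r + 1) = c) (hr : cnt w s q r < c) : τ ≤ q := by
  by_contra h1
  have := h.below q hq.le hqN
  rw [if_neg h1] at this
  omega

lemma SlideState.cnt_below_le (h : SlideState n k N s C old w f r c τ) {t : ℕ} (hst : s ≤ t)
    (htN : t ≤ N) : cnt w s t (r + 1) ≤ cnt w s t r + 1 := by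
  have := h.below t hst htN
  split_ifs at this <;> omega

lemma SlideState.down (h : SlideState n k N s C old w f r c τ) {q : ℕ} (hq : s < q)
    (hqN : q ≤ N) (hw : w q = r + 1) (hc : cnt w s q (r + 1) = c) (hr : cnt w s q r < c) :
    SlideState n k N s C old (Function.update w q r) (Function.update f (r, c) (q : ℤ))
      (r + 1) c q := by
  have hrow := h.cnt_row hq hqN hc hr
  have hτ := h.time_le hq hqN hc hr
  have hlt := fun t => h.le_of_lt_down (t := t) hqN hw hc
  have hge := fun t (h1 : q ≤ t) => h.cnt_below_le (t := t) (by omega)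
  have cr : ∀ t, s ≤ t → cnt (Function.update w q r) s t r =
      cnt w s t r + if q ≤ t then 1 else 0 := by
    intro t ht
    have := cnt_update w hq r t r ht
    rw [hw] at this
    simp only [show ¬ (r + 1 = r) by omega, and_false, and_true, if_false] at this
    split_ifs at * <;> omega
  have cr1 : ∀ t, s ≤ t → cnt (Function.update w q r) s t (r + 1) + (if q ≤ t then 1 else 0) =
      cnt w s t (r + 1) := by
    intro t ht
    have := cnt_update w hq r t (r + 1) ht
    rw [hw] at this
    simp only [show ¬ (r = r + 1) by omega, and_false, and_true, if_false] at this
    split_ifs at * <;> omega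
  have co : ∀ t y, s ≤ t → y ≠ r → y ≠ r + 1 →
      cnt (Function.update w q r) s t y = cnt w s t y := by
    intro t y ht h1 h2
    have := cnt_update w hq r t y ht
    rw [hw, if_neg (by omega), if_neg (by omega)] at this
    omega
  have hrn : r + 1 ≤ n := hw ▸ (h.letters q hq hqN).2
  refine ⟨fun j h1 h2 => ?_, by omega, hrn, h.col_pos, ?_, fun y => ?_, ?_, ?_, ?_, ?_, ?_, ?_, ?_⟩
  · by_cases hj : j = q
    · subst hj; rw [Function.update_self]; exact ⟨h.row_pos, h.row_le⟩
    · rw [Function.update_of_ne hj]; exact h.letters j h1 h2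
  · have h1 := h.content (r + 1)
    have h2 := cnt_mono w hq.le hqN (r + 1)
    rw [if_neg (by omega)] at h1
    omega
  · have h1 := h.content y
    by_cases hy : y = r
    · subst hy
      have := cr N (by omega)
      rw [if_pos hqN] at this
      rw [if_pos rfl] at h1
      rw [if_neg (by omega)]; omega
    · by_cases hy1 : y = r + 1
      · subst hy1
        have := cr1 N (by omega)
        rw [if_pos hqN] at this
        rw [if_neg hy] at h1
        rw [if_pos rfl]; omega
      · rw [co N y (by omega) hy hy1, if_neg hy1]
        rwa [if_neg hy] at h1
  · intro y t h1 h2 h3 h4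
    obtain rfl : y = r := by omega
    rw [cr1 t h1, cr t h1]
    split_ifs with h5
    · exact hge t h5 h2
    · exact hlt t h1 (by omega)
  · intro t h1 h2
    rw [co t (r + 1 + 1) h1 (by omega) (by omega), cr1 t h1]
    exact h.other (r + 1) t h1 h2 (by omega) (by omega)
  · intro y t h1 h2 h3 h4
    by_cases hy : y = r
    · subst hy
      have a := cr t h1
      have b := cr1 t h1
      split_ifs at a b with h5
      · have := hge t h5 h2; omega
      · have := hlt t h1 (by omega); omega
    · by_cases hy1 : y + 1 = r
      · have a := h.above y t h1 h2 h3 hy1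
        rw [hy1, cr t h1, co t y h1 hy (by omega)]
        split_ifs at a ⊢ <;> omega
      · rw [co t y h1 hy h4, co t (y + 1) h1 hy1 (by omega)]
        exact h.other y t h1 h2 h3 hy
  · intro t h1 h2 h3
    have a := cr1 t h1
    rw [co t (r + 1 + 1) h1 (by omega) (by omega)]
    have b := h.other (r + 1) t h1 h2 (by omega) (by omega)
    split_ifs at a with h5
    · have := cnt_mono w hq.le h5 (r + 1)
      omega
    · omega
  · intro j h1 h2 h3
    by_cases hj : j = q
    · subst hj
      have := cr j h1.le
      rw [if_pos le_rfl] at this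
      rw [Function.update_self, this, hrow, Function.update_self]
    · rw [Function.update_of_ne hj] at h3 ⊢
      by_cases hy : w j = r
      · have a := cr j h1.le
        rw [hy, a]
        rcases Nat.lt_or_gt_of_ne hj with h5 | h5
        · have b := cnt_mono w h1.le h5.le r
          rw [if_neg (by omega), add_zero, Function.update_of_ne (by simp; omega), ← hy]
          rw [← hy] at b hrow
          exact h.entry j h1 h2 fun _ => by rw [← hy]; omega
        · have b := cnt_lt w hq.le h5 hy
          rw [if_pos h5.le, Function.update_of_ne (by simp; omega)]
          exact h.entry_right j h1 h2 hy (by omega)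
      · rw [Function.update_of_ne (by simp [hy])]
        by_cases hy1 : w j = r + 1
        · have a := cr1 j h1.le
          have b := h3 hy1
          rcases Nat.lt_or_gt_of_ne hj with h5 | h5
          · rw [if_neg (by omega), add_zero] at a
            rw [hy1, a, ← hy1]
            exact h.entry j h1 h2 fun e => absurd e hy
          · have := cnt_lt w hq.le h5 hy1
            rw [if_pos h5.le] at a
            omega
        · rw [co j (w j) h1.le hy hy1]
          exact h.entry j h1 h2 fun e => absurd e hy
  · intro j h1 h2 h3 h4
    have hj : j ≠ q := by
      rintro rfl
      rw [Function.update_self] at h3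
      omega
    rw [Function.update_of_ne hj] at h3
    have a := cr1 j h1.le
    have h5 : q < j := by
      by_contra h6
      have := cnt_lt w h1.le (show j < q by omega) hw
      omega
    rw [if_pos h5.le] at a
    rw [a, Function.update_of_ne (by simp), ← h3]
    exact h.entry j h1 h2 fun e => by omega
  · intro y c' h1 h2 h3 h4
    rw [Function.update_of_ne]
    · exact h.rest y c' h1 h2 h3 h4
    · rintro h5
      obtain ⟨rfl, rfl⟩ := Prod.mk.inj h5
      have := h.col_le
      omega

lemma SlideState.reach_down (h : SlideState n k N s C old w f r c τ) {q : ℕ} (hq : s < q)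
    (hqN : q ≤ N) (hw : w q = r + 1) (hc : cnt w s q (r + 1) = c) (hr : cnt w s q r < c)
    {s' : ℕ} (hs : s ≤ s') (m K : ℤ) :
    Reach n m w s' N K ↔ Reach n m (Function.update w q r) s' N K := by
  have hrow := h.cnt_row hq hqN hc hr
  have hrn : r + 1 ≤ n := hw ▸ (h.letters q hq hqN).2
  constructor
  · refine Reach.raise h.row_pos hrn hqN hw fun t h1 h2 => ?_
    have a := cnt_add w hq.le h1 r
    have b := cnt_add w hq.le h1 (r + 1)
    have d := h.cnt_below_le (by omega) h2
    omega
  · refine Reach.of_raise h.row_pos hrn hqN hw fun t h1 h2 => ?_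
    have a := cnt_add w (show s ≤ t by omega) (show t ≤ q - 1 by omega) r
    have b := cnt_add w (show s ≤ t by omega) (show t ≤ q - 1 by omega) (r + 1)
    have a' := cnt_pred w hq r
    have b' := cnt_pred w hq (r + 1)
    rw [hw, if_neg (by omega)] at a'
    rw [hw, if_pos rfl] at b'
    have d := h.le_of_lt_down hqN hw hc (show s ≤ t by omega) h2
    omega

/-- The outcome `f'` of a slide: its positive entries are given by the Yamanouchi word `w'`,
which is equivalent to `w`, and the last cell of row `b` of the shape `C` contains `v`. -/
structure SlideResult (n k N s : ℕ) (C : ℕ → ℕ) (old : Filling) (w w' : ℕ → ℕ) (b : ℕ) (v : ℤ)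
    (f' : Filling) : Prop where
  letters : ∀ j, s < j → j ≤ N → 1 ≤ w' j ∧ w' j ≤ n
  row_pos : 1 ≤ b
  row_le : b ≤ n
  content : ∀ y, cnt w' s N y + (if y = b then 1 else 0) = C y
  yam : ∀ t, s ≤ t → t ≤ N → ∀ y, 1 ≤ y → cnt w' s t (y + 1) ≤ cnt w' s t y
  entry : ∀ j, s < j → j ≤ N → f' (w' j, cnt w' s j (w' j)) = j
  last : f' (b, C b) = v
  rest : ∀ y c', 1 ≤ y → y ≤ n → C y < c' → c' ≤ k → f' (y, c') = old (y, c')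
  reach : ∀ s' (m K : ℤ), s ≤ s' → (Reach n m w s' N K ↔ Reach n m w' s' N K)

lemma SlideState.pos_iff (h : SlideState n k N s C old w f r c τ) (hsN : s ≤ N)
    (hold : ∀ y c', 1 ≤ y → y ≤ n → C y < c' → c' ≤ k → old (y, c') ≤ 0) (hc : c + 1 ≤ k) :
    0 < f (r, c + 1) ↔ c ≤ cnt w s N r := by
  have h1 := h.content r
  rw [if_pos rfl] at h1
  constructor
  · intro h2
    by_contra h3
    have a := h.rest r (c + 1) h.row_pos h.row_le (by omega) hc
    have b := hold r (c + 1) h.row_pos h.row_le (by omega) hc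
    omega
  · intro h2
    obtain ⟨j, a, b, d, e⟩ := exists_occurrence w hsN h.col_pos h2
    have := h.entry_right j a b d e.ge
    rw [e] at this
    omega

lemma SlideState.pos_iff_below (h : SlideState n k N s C old w f r c τ) (hsN : s ≤ N)
    (hold : ∀ y c', 1 ≤ y → y ≤ n → C y < c' → c' ≤ k → old (y, c') ≤ 0) (hk : C r ≤ k)
    (hr : r + 1 ≤ n) : 0 < f (r + 1, c) ↔ c ≤ cnt w s N (r + 1) := by
  have h1 := h.content (r + 1)
  have h0 := h.col_le
  rw [if_neg (by omega)] at h1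
  constructor
  · intro h2
    by_contra h3
    have a := h.rest (r + 1) c (by omega) hr (by omega) (by omega)
    have b := hold (r + 1) c (by omega) hr (by omega) (by omega)
    omega
  · intro h2
    obtain ⟨j, a, b, d, e⟩ := exists_occurrence w hsN h.col_pos h2
    have := h.entry j a b fun h5 => by omega
    rw [d, e] at this
    omega

lemma SlideState.exists_result (hsN : s ≤ N) (hC : ∀ y, 1 ≤ y → y ≤ n → C y ≤ k)
    (hold : ∀ y c', 1 ≤ y → y ≤ n → C y < c' → c' ≤ k → old (y, c') ≤ 0) (v : ℤ)
    (h : SlideState n k N s C old w f r c τ) :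
    ∃ w' b, SlideResult n k N s C old w w' b v (slideAndFill n k v f r c) := by
  obtain ⟨d, hd⟩ : ∃ d, d = (n - r) + (k - c) := ⟨_, rfl⟩
  induction d using Nat.strong_induction_on generalizing w f r c τ with
  | _ d ih =>
  have hk := hC r h.row_pos h.row_le
  have hcon := h.content r
  rw [if_pos rfl] at hcon
  have hcol := h.col_le
  have noBelow : r + 1 ≤ n ∨ cnt w s N (r + 1) = 0 := by
    by_contra h1
    push Not at h1
    obtain ⟨j, a, b, e, -⟩ := exists_occurrence w hsN le_rfl (show 1 ≤ cnt w s N (r + 1) by omega)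
    have := (h.letters j a b).2
    omega
  rw [slideAndFill]
  split_ifs with hdown hright
  · obtain ⟨h1, h2, h3⟩ := hdown
    obtain ⟨q, hq, hqN, hw, hcq⟩ := exists_occurrence w hsN h.col_pos
      ((h.pos_iff_below hsN hold hk h1).1 h2)
    have e := h.entry q hq hqN fun h5 => by omega
    rw [hw, hcq] at e
    have hr : cnt w s q r < c := by
      by_contra h5
      have h6 : c ≤ cnt w s N r := (by omega : c ≤ cnt w s q r).trans (cnt_mono w hq.le hqN r)
      have h7 : c + 1 ≤ k := by omega
      have h8 := h3 ⟨h7, (h.pos_iff hsN hold h7).2 h6⟩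
      obtain ⟨j, a, b, d, e'⟩ := exists_occurrence w hq.le h.col_pos (show c ≤ cnt w s q r by omega)
      have := h.entry_right j a (by omega) d e'.ge
      rw [e'] at this
      omega
    rw [e]
    have hdn := h.down hq hqN hw hcq hr
    obtain ⟨w', b, hres⟩ := ih _ (by omega) hdn rfl
    exact ⟨w', b, hres.letters, hres.row_pos, hres.row_le, hres.content, hres.yam, hres.entry,
      hres.last, hres.rest, fun s' m K hs =>
        (h.reach_down hq hqN hw hcq hr hs m K).trans (hres.reach s' m K hs)⟩
  · obtain ⟨h1, h2⟩ := hright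
    obtain ⟨j, hj, hjN, hw, hcj⟩ := exists_occurrence w hsN h.col_pos
      ((h.pos_iff hsN hold h1).1 h2)
    have e := h.entry_right j hj hjN hw hcj.ge
    rw [hcj] at e
    rw [e]
    refine ih _ (by omega) (h.right hj hjN hw hcj fun t h3 h4 h5 => ?_) rfl
    by_contra h6
    rcases noBelow with h7 | h7
    · have h8 : c ≤ cnt w s t (r + 1) := by
        by_contra h9
        have := h.left t h3 h4 (by omega)
        omega
      obtain ⟨q, hq, hqN, hwq, hcq⟩ := exists_occurrence w h3 h.col_pos h8
      have e' := h.entry q hq (by omega) fun h5 => by omega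
      rw [hwq, hcq] at e'
      have htj : t < j := by
        by_contra h9
        have := cnt_mono w hj.le (show j ≤ t by omega) r
        omega
      exact hdown ⟨h7, by omega, fun _ => by omega⟩
    · have := cnt_mono w h3 h4 (r + 1)
      omega
  · have hend : c = C r := by
      by_contra h1
      have h2 : c + 1 ≤ k := by omega
      exact hright ⟨h2, (h.pos_iff hsN hold h2).2 (by omega)⟩
    have hbelow : ¬ c ≤ cnt w s N (r + 1) := by
      intro h1
      rcases noBelow with h2 | h2
      · exact hdown ⟨h2, (h.pos_iff_below hsN hold hk h2).2 h1, fun h3 => absurd h3 hright⟩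
      · have := h.col_pos; omega
    refine ⟨w, r, h.letters, h.row_pos, h.row_le, h.content, fun t h1 h2 y h3 => ?_,
      fun j h1 h2 => ?_, ?_, fun y c' h1 h2 h3 h4 => ?_, fun _ _ _ _ => Iff.rfl⟩
    · by_cases hy : y = r
      · subst hy
        by_cases h4 : cnt w s t y + 1 < c
        · exact h.left t h1 h2 h4
        · have := cnt_mono w h1 h2 (y + 1)
          omega
      · exact h.other y t h1 h2 h3 hy
    · have h3 : w j = r → cnt w s j r < c := fun _ => by
        have := cnt_mono w h1.le h2 r
        omega
      rw [Function.update_of_ne]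
      · exact h.entry j h1 h2 h3
      · intro h4
        obtain ⟨h5, h6⟩ := Prod.mk.inj h4
        rw [h5] at h6
        have := h3 h5
        omega
    · rw [← hend, Function.update_self]
    · rw [Function.update_of_ne]
      · exact h.rest y c' h1 h2 h3 h4
      · intro h5
        obtain ⟨rfl, rfl⟩ := Prod.mk.inj h5
        omega

end Slide

/-- The state of the evacuation after `i` rounds: the positive entries of `f` are `i + 1, …, N`, and
they are given by the Yamanouchi word `w` of their rows. -/
structure EvacState (n k N i : ℕ) (w : ℕ → ℕ) (f : Filling) : Prop where
  letters : ∀ j, i < j → j ≤ N → 1 ≤ w j ∧ w j ≤ n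
  yam : ∀ t, i ≤ t → t ≤ N → ∀ y, 1 ≤ y → cnt w i t (y + 1) ≤ cnt w i t y
  bound : ∀ y, 1 ≤ y → y ≤ n → cnt w i N y ≤ k
  entry : ∀ j, i < j → j ≤ N → f (w j, cnt w i j (w j)) = j
  nonpos : ∀ y c, 1 ≤ y → y ≤ n → cnt w i N y < c → c ≤ k → f (y, c) ≤ 0

section Evac

variable {n k N i : ℕ} {w : ℕ → ℕ} {f : Filling}

lemma EvacState.head (h : EvacState n k N i w f) (hi : i < N) : w (i + 1) = 1 := by
  have h1 := h.letters (i + 1) (by omega) hi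
  by_contra h2
  have h3 := h.yam (i + 1) (by omega) hi (w (i + 1) - 1) (by omega)
  rw [show w (i + 1) - 1 + 1 = w (i + 1) by omega, cnt_succ w le_rfl, cnt_succ w le_rfl, cnt_self,
    cnt_self, if_pos rfl, if_neg (by omega)] at h3
  omega

lemma EvacState.slideState (h : EvacState n k N i w f) (hi : i < N) :
    SlideState n k N (i + 1) (cnt w i N) f w f 1 1 (i + 1) := by
  have hw := h.head hi
  have hh := fun t (ht : i + 1 ≤ t) y => cnt_head w (show i < t by omega) y
  simp only [hw] at hh
  refine ⟨fun j h1 h2 => h.letters j (by omega) h2, le_rfl, ?_, le_rfl, ?_, fun y => ?_,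
    fun y t _ _ h3 h4 => by omega, fun t h1 h2 => ?_, fun y t h1 h2 h3 h4 => ?_,
    fun t _ _ h3 => by omega, fun j h1 h2 h3 => ?_, fun j h1 h2 h3 _ => ?_,
    fun y c _ _ _ _ => rfl⟩
  · have := h.letters (i + 1) (by omega) hi
    omega
  · have := hh N hi 1
    rw [if_pos rfl] at this
    omega
  · rw [hh N hi y]
    simp only [eq_comm]
  · have := h.yam t (by omega) h2 1 le_rfl
    rw [hh t h1, hh t h1, if_neg (by omega), if_pos rfl] at this
    rw [if_pos h1]
    exact this
  · have := h.yam t (by omega) h2 y h3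
    rwa [hh t h1, hh t h1, if_neg (by omega), if_neg (by omega)] at this
  · have h4 := h.entry j (by omega) h2
    rw [hh j h1.le] at h4
    by_cases h5 : w j = 1
    · have := h3 h5
      have := cnt_lt w le_rfl h1 h5
      omega
    · rwa [if_neg (fun e => h5 e.symm), add_zero] at h4
  · have h4 := h.entry j (by omega) h2
    rwa [hh j h1.le, h3, if_pos rfl] at h4

lemma EvacState.exists_result (h : EvacState n k N i w f) (hi : i < N) :
    ∃ w' b, SlideResult n k N (i + 1) (cnt w i N) f w w' b (-((i : ℤ) + 1))
      (evacuationStep n k f) := by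
  have h1 : f (1, 1) = (i : ℤ) + 1 := by
    have := h.entry (i + 1) (by omega) hi
    rw [h.head hi, cnt_succ w le_rfl, cnt_self, h.head hi] at this
    exact_mod_cast this
  rw [evacuationStep, h1]
  exact (h.slideState hi).exists_result hi h.bound h.nonpos _

lemma EvacState.next (h : EvacState n k N i w f) {w' : ℕ → ℕ} {b : ℕ} {f' : Filling}
    (hr : SlideResult n k N (i + 1) (cnt w i N) f w w' b (-((i : ℤ) + 1)) f') :
    EvacState n k N (i + 1) w' f' := by
  refine ⟨hr.letters, hr.yam, fun y h1 h2 => ?_, hr.entry, fun y c h1 h2 h3 h4 => ?_⟩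
  · have := h.bound y h1 h2
    have := hr.content y
    omega
  · have h5 := hr.content y
    by_cases h6 : cnt w i N y < c
    · rw [hr.rest y c h1 h2 h6 h4]
      exact h.nonpos y c h1 h2 h6 h4
    · split_ifs at h5 with h7
      · obtain rfl : c = cnt w i N y := by omega
        rw [h7, hr.last]
        omega
      · omega

end Evac

/-- The number of entries at most `t` in row `y`. -/
def rowCount (k : ℕ) (T : Filling) (y : ℕ) (t : ℤ) : ℕ :=
  ((Finset.Icc 1 k).filter (fun c => T (y, c) ≤ t)).card

open Classical in
/-- The row of the entry `j`. -/
noncomputable def rowOf (n k : ℕ) (T : Filling) (j : ℕ) : ℕ :=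
  if h : ∃ p ∈ cells n k, T p = j then h.choose.1 else 0

lemma mem_cells {n k y c : ℕ} : (y, c) ∈ cells n k ↔ (1 ≤ y ∧ y ≤ n) ∧ 1 ≤ c ∧ c ≤ k := by
  simp [cells]

section Tableau

variable {n k : ℕ} {T : Filling}

lemma IsSYT.exists_cell (hT : IsSYT n k T) {j : ℤ} (h1 : 1 ≤ j) (h2 : j ≤ n * k) :
    ∃ y c, (y, c) ∈ cells n k ∧ T (y, c) = j := by
  obtain ⟨p, hp, h⟩ := hT.bijOn.surjOn ⟨h1, h2⟩
  exact ⟨p.1, p.2, hp, h⟩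

lemma IsSYT.entry_bounds (hT : IsSYT n k T) {y c : ℕ} (h : (y, c) ∈ cells n k) :
    1 ≤ T (y, c) ∧ T (y, c) ≤ n * k :=
  hT.bijOn.mapsTo h

lemma IsSYT.rowOf_eq (hT : IsSYT n k T) {y c j : ℕ} (h : (y, c) ∈ cells n k) (hj : T (y, c) = j) :
    rowOf n k T j = y := by
  have hex : ∃ p ∈ cells n k, T p = j := ⟨_, h, hj⟩
  rw [rowOf, dif_pos hex]
  have := hT.bijOn.injOn hex.choose_spec.1 h (hex.choose_spec.2.trans hj.symm)
  rw [this]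

lemma IsSYT.row_le_iff (hT : IsSYT n k T) {y c c' : ℕ} (h : (y, c) ∈ cells n k)
    (h' : (y, c') ∈ cells n k) :
    T (y, c) ≤ T (y, c') ↔ c ≤ c' := by
  constructor
  · intro h1
    by_contra h2
    have := hT.row_lt y c' c h' h (by omega)
    omega
  · intro h1
    rcases h1.eq_or_lt with rfl | h2
    · exact le_rfl
    · exact (hT.row_lt y c c' h h' h2).le

lemma IsSYT.rowCount_entry (hT : IsSYT n k T) {y c : ℕ} (h : (y, c) ∈ cells n k) :
    rowCount k T y (T (y, c)) = c := by
  rw [mem_cells] at h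
  have : (Finset.Icc 1 k).filter (fun c' => T (y, c') ≤ T (y, c)) = Finset.Icc 1 c := by
    ext c'
    simp only [Finset.mem_filter, Finset.mem_Icc]
    constructor
    · rintro ⟨h1, h2⟩
      exact ⟨h1.1, (hT.row_le_iff (mem_cells.2 ⟨h.1, h1⟩) (mem_cells.2 h)).1 h2⟩
    · rintro ⟨h1, h2⟩
      have h3 : 1 ≤ c' ∧ c' ≤ k := ⟨h1, by omega⟩
      exact ⟨h3, (hT.row_le_iff (mem_cells.2 ⟨h.1, h3⟩) (mem_cells.2 h)).2 h2⟩
  rw [rowCount, this, Nat.card_Icc, Nat.add_sub_cancel]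

lemma IsSYT.rowCount_succ_le (hT : IsSYT n k T) {y : ℕ} (h1 : 1 ≤ y) (h2 : y < n) (t : ℤ) :
    rowCount k T (y + 1) t ≤ rowCount k T y t := by
  refine Finset.card_le_card fun c hc => ?_
  simp only [Finset.mem_filter, Finset.mem_Icc] at hc ⊢
  have := hT.col_lt y (y + 1) c (mem_cells.2 ⟨⟨h1, by omega⟩, hc.1⟩)
    (mem_cells.2 ⟨⟨by omega, h2⟩, hc.1⟩) (by omega)
  exact ⟨hc.1, by omega⟩

lemma IsSYT.rowCount_top (hT : IsSYT n k T) {y : ℕ} (h1 : 1 ≤ y) (h2 : y ≤ n) :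
    rowCount k T y ((n : ℤ) * k) = k := by
  rw [rowCount, Finset.filter_true_of_mem, Nat.card_Icc, Nat.add_sub_cancel]
  intro c hc
  exact (hT.entry_bounds (mem_cells.2 ⟨⟨h1, h2⟩, Finset.mem_Icc.1 hc⟩)).2

lemma IsSYT.cnt_rowOf (hT : IsSYT n k T) {y t : ℕ} (h1 : 1 ≤ y) (h2 : y ≤ n) (ht : t ≤ n * k) :
    cnt (rowOf n k T) 0 t y = rowCount k T y t := by
  symm
  refine Finset.card_bij (fun c _ => (T (y, c)).toNat) ?_ ?_ ?_
  · intro c hc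
    simp only [Finset.mem_filter, Finset.mem_Icc, Finset.mem_Ioc] at hc ⊢
    have hcell := mem_cells.2 ⟨⟨h1, h2⟩, hc.1⟩
    have := hT.entry_bounds hcell
    exact ⟨by omega, hT.rowOf_eq hcell (by omega)⟩
  · intro c hc c' hc' h
    simp only [Finset.mem_filter, Finset.mem_Icc] at hc hc'
    have a := mem_cells.2 ⟨⟨h1, h2⟩, hc.1⟩
    have b := mem_cells.2 ⟨⟨h1, h2⟩, hc'.1⟩
    have := hT.entry_bounds a
    have := hT.entry_bounds b
    have := hT.bijOn.injOn a b (by omega)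
    exact (Prod.mk.inj this).2
  · intro j hj
    simp only [Finset.mem_filter, Finset.mem_Ioc] at hj
    obtain ⟨z, c, hp, hTp⟩ := hT.exists_cell (j := j) (by omega) (by
      have : (j : ℤ) ≤ ((n * k : ℕ) : ℤ) := by exact_mod_cast (by omega : j ≤ n * k)
      exact_mod_cast this)
    obtain rfl : z = y := (hT.rowOf_eq hp hTp).symm.trans hj.2
    refine ⟨c, ?_, by omega⟩
    simp only [Finset.mem_filter, Finset.mem_Icc]
    exact ⟨(mem_cells.1 hp).2, by omega⟩

lemma IsSYT.cnt_rowOf_top (hT : IsSYT n k T) {y : ℕ} (h1 : 1 ≤ y) (h2 : y ≤ n) :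
    cnt (rowOf n k T) 0 (n * k) y = k := by
  rw [hT.cnt_rowOf h1 h2 le_rfl]
  exact_mod_cast hT.rowCount_top h1 h2

lemma IsSYT.exists_cell_rowOf (hT : IsSYT n k T) {j : ℕ} (h1 : 0 < j) (h2 : j ≤ n * k) :
    ∃ c, (rowOf n k T j, c) ∈ cells n k ∧ T (rowOf n k T j, c) = j ∧
      cnt (rowOf n k T) 0 j (rowOf n k T j) = c := by
  obtain ⟨y, c, hp, hTp⟩ := hT.exists_cell (j := j) (by omega) (by exact_mod_cast h2)
  have e := hT.rowOf_eq hp hTp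
  rw [e]
  refine ⟨c, hp, hTp, ?_⟩
  rw [hT.cnt_rowOf (mem_cells.1 hp).1.1 (mem_cells.1 hp).1.2 h2, ← hTp, hT.rowCount_entry hp]

lemma IsSYT.rowOf_bounds (hT : IsSYT n k T) {j : ℕ} (h1 : 0 < j) (h2 : j ≤ n * k) :
    1 ≤ rowOf n k T j ∧ rowOf n k T j ≤ n := by
  obtain ⟨c, hp, -⟩ := hT.exists_cell_rowOf h1 h2
  exact (mem_cells.1 hp).1

lemma IsSYT.evacState (hT : IsSYT n k T) : EvacState n k (n * k) 0 (rowOf n k T) T := by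
  refine ⟨fun j h1 h2 => hT.rowOf_bounds h1 h2, fun t h1 h2 y h3 => ?_,
    fun y h1 h2 => (hT.cnt_rowOf_top h1 h2).le, fun j h1 h2 => ?_, fun y c h1 h2 h3 h4 => ?_⟩
  · by_cases h4 : y < n
    · rw [hT.cnt_rowOf h3 h4.le h2, hT.cnt_rowOf (by omega) h4 h2]
      exact hT.rowCount_succ_le h3 h4 t
    · rw [Nat.le_iff_lt_or_eq]
      by_contra h5
      obtain ⟨j, a, b, e, -⟩ := exists_occurrence (rowOf n k T) h1 le_rfl
        (show 1 ≤ cnt (rowOf n k T) 0 t (y + 1) by omega)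
      have := (hT.rowOf_bounds a (b.trans h2)).2
      omega
  · obtain ⟨c, -, h3, h4⟩ := hT.exists_cell_rowOf h1 h2
    rw [h4, h3]
  · rw [hT.cnt_rowOf_top h1 h2] at h3
    omega

lemma IsSYT.cnt_rowOf_final_le (hT : IsSYT n k T) {t y : ℕ} (ht : t ≤ n * k) (h1 : 1 ≤ y)
    (h2 : y < n) :
    cnt (rowOf n k T) t (n * k) y ≤ cnt (rowOf n k T) t (n * k) (y + 1) := by
  have a := hT.cnt_rowOf_top h1 h2.le
  have b := hT.cnt_rowOf_top (show 1 ≤ y + 1 by omega) h2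
  rw [cnt_add _ (Nat.zero_le t) ht] at a b
  have e := hT.evacState.yam t (Nat.zero_le t) ht y h1
  omega

lemma IsSYT.cnt_eq_of_reach (hT : IsSYT n k T) {i : ℕ} {w : ℕ → ℕ} {f : Filling} (hi : i ≤ n * k)
    (h : EvacState n k (n * k) i w f)
    (hr : ∀ m K : ℤ, Reach n m (rowOf n k T) i (n * k) K ↔ Reach n m w i (n * k) K) {y : ℕ}
    (h1 : 1 ≤ y) (h2 : y ≤ n) :
    cnt w i (n * k) y = cnt (rowOf n k T) i (n * k) (n + 1 - y) :=
  cnt_eq_cnt_reverse hi h.letters (fun t a b y c _ => h.yam t a b y c)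
    (fun _ a b => hT.rowOf_bounds (by omega) b)
    (fun _ _ b _ c d => hT.cnt_rowOf_final_le b c d) (fun m K => (hr m K).symm) h1 h2

lemma IsSYT.exists_evacState (hT : IsSYT n k T) (i : ℕ) (hi : i ≤ n * k) :
    ∃ w, EvacState n k (n * k) i w ((evacuationStep n k)^[i] T) ∧
      (∀ s (m K : ℤ), i ≤ s →
        (Reach n m (rowOf n k T) s (n * k) K ↔ Reach n m w s (n * k) K)) ∧
      ∀ y c, 1 ≤ y → y ≤ n → cnt (rowOf n k T) i (n * k) (n + 1 - y) < c → c ≤ k →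
        (evacuationStep n k)^[i] T (y, c) = -T (n + 1 - y, k + 1 - c) := by
  induction i with
  | zero =>
    refine ⟨_, hT.evacState, fun _ _ _ _ => Iff.rfl, fun y c h1 h2 h3 h4 => ?_⟩
    rw [hT.cnt_rowOf_top (by omega) (by omega)] at h3
    omega
  | succ i ih =>
    obtain ⟨w, hst, hreach, hneg⟩ := ih (by omega)
    rw [Function.iterate_succ_apply']
    obtain ⟨w', b, hres⟩ := hst.exists_result hi
    have hst' := hst.next hres
    have hreach' : ∀ s (m K : ℤ), i + 1 ≤ s →
        (Reach n m (rowOf n k T) s (n * k) K ↔ Reach n m w' s (n * k) K) :=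
      fun s m K hs => (hreach s m K (by omega)).trans (hres.reach s m K hs)
    refine ⟨w', hst', hreach', fun y c h1 h2 h3 h4 => ?_⟩
    have e := hT.cnt_eq_of_reach (by omega) hst (fun m K => hreach i m K le_rfl) h1 h2
    by_cases h5 : cnt w i (n * k) y < c
    · rw [hres.rest y c h1 h2 h5 h4]
      exact hneg y c h1 h2 (by omega) h4
    · have e' := hT.cnt_eq_of_reach hi hst' (fun m K => hreach' _ m K le_rfl) h1 h2
      have hc := hres.content y
      obtain rfl : y = b := by
        by_contra h6
        rw [if_neg h6] at hc
        omega
      rw [if_pos rfl] at hc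
      obtain rfl : c = cnt w i (n * k) y := by omega
      rw [hres.last]
      obtain ⟨c, hp, hTp, hcnt⟩ := hT.exists_cell_rowOf (Nat.succ_pos i) hi
      have hh := cnt_head (rowOf n k T) hi (n + 1 - y)
      have hrow : rowOf n k T (i + 1) = n + 1 - y := by
        by_contra h6
        rw [if_neg h6] at hh
        omega
      have htop := hT.cnt_rowOf_top (show 1 ≤ n + 1 - y by omega) (by omega)
      rw [cnt_add _ (Nat.zero_le (i + 1)) hi] at htop
      rw [Nat.succ_eq_add_one, hrow] at hp hTp hcnt
      rw [hrow, if_pos rfl] at hh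
      rw [show k + 1 - cnt w i (n * k) y = c by omega, hTp]
      push_cast
      rfl

/-- Evacuation of a rectangular tableau is the rotation by a half-turn followed by the
complementation of the entries. -/
lemma IsSYT.evacuation_eq (hT : IsSYT n k T) {y c : ℕ} (h : (y, c) ∈ cells n k) :
    evacuation n k T (y, c) = (n : ℤ) * k + 1 - T (n + 1 - y, k + 1 - c) := by
  rw [mem_cells] at h
  obtain ⟨w, -, -, hneg⟩ := hT.exists_evacState (n * k) le_rfl
  rw [evacuation, hneg y c h.1.1 h.1.2 (by rw [cnt_self]; omega) h.2.2]
  ring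

end Tableau

lemma IsSYT.of_eq_rotate {n k : ℕ} {T S : Filling} (hT : IsSYT n k T)
    (hS : ∀ y c, (y, c) ∈ cells n k → S (y, c) = (n : ℤ) * k + 1 - T (n + 1 - y, k + 1 - c)) :
    IsSYT n k S := by
  have hcell : ∀ {y c}, (y, c) ∈ cells n k → (n + 1 - y, k + 1 - c) ∈ cells n k := by
    intro y c h
    rw [mem_cells] at h ⊢
    omega
  refine ⟨⟨?_, ?_, ?_⟩, ?_, ?_⟩
  · rintro ⟨y, c⟩ h
    have := hT.entry_bounds (hcell h)
    rw [hS y c h, Set.mem_Icc]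
    omega
  · rintro ⟨y, c⟩ h ⟨y', c'⟩ h' e
    rw [hS y c h, hS y' c' h'] at e
    have := hT.bijOn.injOn (hcell h) (hcell h') (by omega)
    rw [Prod.mk.injEq] at this
    have h := mem_cells.1 h
    have h' := mem_cells.1 h'
    ext <;> simp <;> omega
  · rintro j ⟨h1, h2⟩
    obtain ⟨y, c, hp, hTp⟩ := hT.exists_cell (j := (n : ℤ) * k + 1 - j) (by omega) (by omega)
    refine ⟨_, hcell hp, ?_⟩
    rw [hS _ _ (hcell hp)]
    rw [mem_cells] at hp
    rw [show n + 1 - (n + 1 - y) = y by omega, show k + 1 - (k + 1 - c) = c by omega]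
    omega
  · intro y c c' h h' hlt
    rw [hS y c h, hS y c' h']
    have a := mem_cells.1 h
    have b := mem_cells.1 h'
    have := hT.row_lt _ _ _ (hcell h') (hcell h) (by omega)
    omega
  · intro y y' c h h' hlt
    rw [hS y c h, hS y' c h']
    have a := mem_cells.1 h
    have b := mem_cells.1 h'
    have := hT.col_lt _ _ _ (hcell h') (hcell h) (by omega)
    omega

/-- The excess of row `x` over row `x + 1` among the entries up to `t`. -/
def excess (k : ℕ) (T : Filling) (x : ℕ) (t : ℤ) : ℤ := rowCount k T x t - rowCount k T (x + 1) t

/-- The entry `i` of row `x` and the entry `j` of row `x + 1` are matching parentheses. -/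
structure IsArc (k : ℕ) (T : Filling) (x : ℕ) (i j : ℤ) : Prop where
  mem_left : ∃ c, 1 ≤ c ∧ c ≤ k ∧ T (x, c) = i
  mem_right : ∃ c, 1 ≤ c ∧ c ≤ k ∧ T (x + 1, c) = j
  lt : i < j
  balanced : excess k T x (j - 1) = excess k T x i
  le : ∀ t, i ≤ t → t < j → excess k T x i ≤ excess k T x t

section Arcs

variable {n k : ℕ} {T : Filling} {x : ℕ}

open Classical in
lemma IsSYT.rowCount_sub_one (hT : IsSYT n k T) {y : ℕ} (h1 : 1 ≤ y) (h2 : y ≤ n) (t : ℤ) :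
    (rowCount k T y t : ℤ) =
      rowCount k T y (t - 1) + if ∃ c, 1 ≤ c ∧ c ≤ k ∧ T (y, c) = t then 1 else 0 := by
  split_ifs with h
  · obtain ⟨c, h3, h4, rfl⟩ := h
    have hc := mem_cells.2 ⟨⟨h1, h2⟩, h3, h4⟩
    rw [hT.rowCount_entry hc]
    have : (Finset.Icc 1 k).filter (fun c' => T (y, c') ≤ T (y, c) - 1) = Finset.Icc 1 (c - 1) := by
      ext c'
      simp only [Finset.mem_filter, Finset.mem_Icc]
      constructor
      · rintro ⟨h5, h6⟩
        have := hT.row_le_iff hc (mem_cells.2 ⟨⟨h1, h2⟩, h5⟩)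
        omega
      · rintro ⟨h5, h6⟩
        have h7 : 1 ≤ c' ∧ c' ≤ k := by omega
        have := hT.row_le_iff hc (mem_cells.2 ⟨⟨h1, h2⟩, h7⟩)
        omega
    rw [rowCount, this, Nat.card_Icc]
    omega
  · rw [add_zero, rowCount, rowCount]
    congr 2
    apply Finset.filter_congr
    intro c hc
    rw [Finset.mem_Icc] at hc
    have : T (y, c) ≠ t := fun h3 => h ⟨c, hc.1, hc.2, h3⟩
    omega

lemma IsSYT.not_mem_succ (hT : IsSYT n k T) (h1 : 1 ≤ x) (h2 : x < n) {t : ℤ}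
    (h : ∃ c, 1 ≤ c ∧ c ≤ k ∧ T (x, c) = t) : ¬ ∃ c, 1 ≤ c ∧ c ≤ k ∧ T (x + 1, c) = t := by
  obtain ⟨c, a, b, rfl⟩ := h
  rintro ⟨c', a', b', e⟩
  have := hT.bijOn.injOn (mem_cells.2 ⟨⟨by omega, h2⟩, a', b'⟩)
    (mem_cells.2 ⟨⟨h1, h2.le⟩, a, b⟩) e
  have := (Prod.mk.inj this).1
  omega

lemma IsSYT.excess_nonneg (hT : IsSYT n k T) (h1 : 1 ≤ x) (h2 : x < n) (t : ℤ) :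
    0 ≤ excess k T x t := by
  have := hT.rowCount_succ_le h1 h2 t
  rw [excess]
  omega

lemma IsSYT.excess_left (hT : IsSYT n k T) (h1 : 1 ≤ x) (h2 : x < n) {t : ℤ}
    (h : ∃ c, 1 ≤ c ∧ c ≤ k ∧ T (x, c) = t) : excess k T x t = excess k T x (t - 1) + 1 := by
  have a := hT.rowCount_sub_one h1 h2.le t
  have b := hT.rowCount_sub_one (show 1 ≤ x + 1 by omega) h2 t
  rw [if_pos h] at a
  rw [if_neg (hT.not_mem_succ h1 h2 h)] at b
  rw [excess, excess]
  omega

lemma IsSYT.excess_right (hT : IsSYT n k T) (h1 : 1 ≤ x) (h2 : x < n) {t : ℤ}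
    (h : ∃ c, 1 ≤ c ∧ c ≤ k ∧ T (x + 1, c) = t) :
    excess k T x t = excess k T x (t - 1) - 1 := by
  have a := hT.rowCount_sub_one h1 h2.le t
  have b := hT.rowCount_sub_one (show 1 ≤ x + 1 by omega) h2 t
  rw [if_pos h] at b
  rw [if_neg fun h' => hT.not_mem_succ h1 h2 h' h] at a
  rw [excess, excess]
  omega

lemma IsSYT.mem_left_of_lt (hT : IsSYT n k T) (h1 : 1 ≤ x) (h2 : x < n) {t : ℤ}
    (h : excess k T x (t - 1) < excess k T x t) : ∃ c, 1 ≤ c ∧ c ≤ k ∧ T (x, c) = t := by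
  by_contra h3
  have a := hT.rowCount_sub_one h1 h2.le t
  have b := hT.rowCount_sub_one (show 1 ≤ x + 1 by omega) h2 t
  rw [if_neg h3] at a
  rw [excess, excess] at h
  split_ifs at b <;> omega

lemma IsSYT.mem_right_of_lt (hT : IsSYT n k T) (h1 : 1 ≤ x) (h2 : x < n) {t : ℤ}
    (h : excess k T x t < excess k T x (t - 1)) : ∃ c, 1 ≤ c ∧ c ≤ k ∧ T (x + 1, c) = t := by
  by_contra h3
  have a := hT.rowCount_sub_one h1 h2.le t
  have b := hT.rowCount_sub_one (show 1 ≤ x + 1 by omega) h2 t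
  rw [if_neg h3] at b
  rw [excess, excess] at h
  split_ifs at a <;> omega

lemma IsSYT.excess_zero (hT : IsSYT n k T) (h1 : 1 ≤ x) (h2 : x < n) {t : ℤ} (ht : t ≤ 0) :
    excess k T x t = 0 := by
  have : rowCount k T x t = 0 := by
    rw [rowCount, Finset.card_eq_zero, Finset.filter_eq_empty_iff]
    intro c hc
    have := hT.entry_bounds (mem_cells.2 ⟨⟨h1, h2.le⟩, Finset.mem_Icc.1 hc⟩)
    omega
  have := hT.rowCount_succ_le h1 h2 t
  rw [excess]
  omega

lemma IsSYT.exists_isArc_of_right (hT : IsSYT n k T) (h1 : 1 ≤ x) (h2 : x < n) {j : ℤ}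
    (h : ∃ c, 1 ≤ c ∧ c ≤ k ∧ T (x + 1, c) = j) : ∃ i, IsArc k T x i j := by
  have hj := hT.excess_right h1 h2 h
  have hpos := hT.excess_nonneg h1 h2 j
  obtain ⟨i, ⟨hi, hlt⟩, hmax⟩ := Int.exists_greatest_of_bdd
    (P := fun i => i < j ∧ excess k T x i < excess k T x (j - 1)) ⟨j, fun z hz => hz.1.le⟩
    ⟨min 0 (j - 1), by omega, by rw [hT.excess_zero h1 h2 (by omega)]; omega⟩
  have hge : ∀ t, i < t → t < j → excess k T x (j - 1) ≤ excess k T x t := by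
    intro t a b
    by_contra h3
    have := hmax t ⟨b, by omega⟩
    omega
  have hij : i + 1 < j := by
    by_contra h3
    obtain rfl : i = j - 1 := by omega
    omega
  have hstep := hge (i + 1) (by omega) hij
  have hmem := hT.mem_left_of_lt h1 h2 (t := i + 1) (by rw [add_sub_cancel_right]; omega)
  have hleft := hT.excess_left h1 h2 hmem
  rw [add_sub_cancel_right] at hleft
  refine ⟨i + 1, hmem, h, hij, by omega, fun t a b => ?_⟩
  have := hge t (by omega) b
  omega

lemma IsArc.right_unique (hT : IsSYT n k T) (h1 : 1 ≤ x) (h2 : x < n) {i i' j : ℤ}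
    (h : IsArc k T x i j) (h' : IsArc k T x i' j) : i' ≤ i := by
  by_contra h3
  have a := h.le (i' - 1) (by omega) (by have := h'.lt; omega)
  have b := hT.excess_left h1 h2 h'.mem_left
  have := h.balanced
  have := h'.balanced
  omega

lemma IsArc.exists_inner (hT : IsSYT n k T) (h1 : 1 ≤ x) (h2 : x < n) {i i' j : ℤ}
    (h : IsArc k T x i j) (hi : i < i') (hj : i' < j)
    (hm : ∃ c, 1 ≤ c ∧ c ≤ k ∧ T (x, c) = i') : ∃ j', j' < j ∧ IsArc k T x i' j' := by
  have a := h.le (i' - 1) (by omega) (by omega)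
  have b := hT.excess_left h1 h2 hm
  have hb := h.balanced
  obtain ⟨j', ⟨hlt, hex⟩, hmin⟩ := Int.exists_least_of_bdd
    (P := fun t => i' < t ∧ excess k T x t < excess k T x i') ⟨i', fun z hz => hz.1.le⟩
    ⟨j - 1, by
      refine lt_of_le_of_ne (by omega) ?_
      rintro rfl
      omega, by omega⟩
  have hge : ∀ t, i' ≤ t → t < j' → excess k T x i' ≤ excess k T x t := by
    intro t a b
    rcases a.eq_or_lt with rfl | a
    · exact le_rfl
    · by_contra h3
      have := hmin t ⟨a, by omega⟩
      omega
  have hjj : j' ≤ j - 1 := by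
    refine hmin _ ⟨?_, by omega⟩
    refine lt_of_le_of_ne (by omega) ?_
    rintro rfl
    omega
  have hp := hge (j' - 1) (by omega) (by omega)
  have hm' := hT.mem_right_of_lt h1 h2 (t := j') (by omega)
  have hr := hT.excess_right h1 h2 hm'
  exact ⟨j', by omega, hm, hm', hlt, by omega, hge⟩

lemma IsSYT.mem_arcsUpTo (hT : IsSYT n k T) (h1 : 1 ≤ x) (h2 : x < n) (m : ℕ) (hm : m ≤ k)
    (i j : ℤ) : (i, j) ∈ arcsUpTo k T x m ↔
      IsArc k T x i j ∧ ∃ c, 1 ≤ c ∧ c ≤ m ∧ T (x + 1, c) = j := by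
  induction m generalizing i j with
  | zero =>
    simp only [arcsUpTo, Finset.notMem_empty, false_iff]
    rintro ⟨-, c, a, b, -⟩
    omega
  | succ m ih =>
    have ih := ih (by omega)
    obtain ⟨i₀, harc⟩ := hT.exists_isArc_of_right h1 h2 (j := T (x + 1, m + 1))
      ⟨m + 1, by omega, hm, rfl⟩
    obtain ⟨c₀, hc1, hck, hc⟩ := harc.mem_left
    have hbelow : ∀ c, 1 ≤ c → c ≤ k → T (x + 1, c) < T (x + 1, m + 1) → c ≤ m := by
      intro c a b hlt
      by_contra h3
      have := (hT.row_le_iff (y := x + 1) (mem_cells.2 ⟨⟨by omega, h2⟩, by omega, hm⟩)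
        (mem_cells.2 ⟨⟨by omega, h2⟩, a, b⟩)).2 (by omega)
      omega
    rw [arcsUpTo]
    set available := (Finset.Icc 1 k).filter (fun c => T (x, c) < T (x + 1, m + 1) ∧
      ∀ a ∈ arcsUpTo k T x m, a.1 ≠ T (x, c)) with hav
    have hmem : c₀ ∈ available := by
      rw [hav, Finset.mem_filter, Finset.mem_Icc, hc]
      refine ⟨⟨hc1, hck⟩, harc.lt, ?_⟩
      rintro ⟨i', j'⟩ ha rfl
      obtain ⟨h3, c, a, b, hj'⟩ := (ih _ _).1 ha
      have hlt : j' < T (x + 1, m + 1) := by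
        rw [← hj']
        exact hT.row_lt _ _ _ (mem_cells.2 ⟨⟨by omega, h2⟩, a, by omega⟩)
          (mem_cells.2 ⟨⟨by omega, h2⟩, by omega, hm⟩) (by omega)
      have e1 := harc.le j' h3.lt.le hlt
      have e2 := hT.excess_right h1 h2 h3.mem_right
      have e3 := h3.balanced
      simp only at e1
      omega
    have hne : available.Nonempty := ⟨c₀, hmem⟩
    have hmax : available.max' hne = c₀ := by
      refine le_antisymm (Finset.max'_le _ _ _ fun c hcm => ?_) (Finset.le_max' _ _ hmem)
      by_contra h3
      rw [hav, Finset.mem_filter, Finset.mem_Icc] at hcm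
      have hlt := hT.row_lt x c₀ c (mem_cells.2 ⟨⟨h1, h2.le⟩, hc1, hck⟩)
        (mem_cells.2 ⟨⟨h1, h2.le⟩, hcm.1⟩) (by omega)
      obtain ⟨j', hj', harc'⟩ := harc.exists_inner hT h1 h2 (hc ▸ hlt) hcm.2.1
        ⟨c, hcm.1.1, hcm.1.2, rfl⟩
      obtain ⟨c', a, b, e⟩ := harc'.mem_right
      exact hcm.2.2 _ ((ih _ _).2 ⟨harc', c', a, hbelow c' a b (e ▸ hj'), e⟩) rfl
    simp only [dif_pos hne, hmax, hc, Finset.mem_insert, Prod.mk.injEq, ih]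
    constructor
    · rintro (⟨rfl, rfl⟩ | ⟨h3, c, a, b, e⟩)
      · exact ⟨harc, m + 1, by omega, le_rfl, rfl⟩
      · exact ⟨h3, c, a, by omega, e⟩
    · rintro ⟨h3, c, a, b, e⟩
      by_cases h4 : c = m + 1
      · subst h4 e
        exact Or.inl ⟨le_antisymm (harc.right_unique hT h1 h2 h3)
          (h3.right_unique hT h1 h2 harc), rfl⟩
      · exact Or.inr ⟨h3, c, a, by omega, e⟩

lemma IsSYT.mem_matching (hT : IsSYT n k T) (h1 : 1 ≤ x) (h2 : x < n) (i j : ℤ) :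
    (x, i, j) ∈ matching n k T ↔ IsArc k T x i j := by
  simp only [matching, Set.mem_ofPred_eq, h1, h2, true_and, hT.mem_arcsUpTo h1 h2 k le_rfl]
  exact ⟨fun h => h.1, fun h => ⟨h, h.mem_right⟩⟩

variable {S : Filling}

lemma rowCount_rotate
    (hS : ∀ y c, (y, c) ∈ cells n k → S (y, c) = (n : ℤ) * k + 1 - T (n + 1 - y, k + 1 - c))
    {y : ℕ} (h1 : 1 ≤ y) (h2 : y ≤ n) (t : ℤ) :
    (rowCount k S y t : ℤ) = k - rowCount k T (n + 1 - y) ((n : ℤ) * k - t) := by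
  have e : rowCount k S y t = ((Finset.Icc 1 k).filter
      (fun c => ¬ T (n + 1 - y, c) ≤ (n : ℤ) * k - t)).card := by
    refine Finset.card_bij (fun c _ => k + 1 - c) ?_ ?_ ?_
    · intro c hc
      simp only [Finset.mem_filter, Finset.mem_Icc] at hc ⊢
      rw [hS y c (mem_cells.2 ⟨⟨h1, h2⟩, hc.1⟩)] at hc
      omega
    · intro c hc c' hc' h
      simp only [Finset.mem_filter, Finset.mem_Icc] at hc hc'
      omega
    · intro c hc
      simp only [Finset.mem_filter, Finset.mem_Icc] at hc
      refine ⟨k + 1 - c, ?_, by omega⟩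
      simp only [Finset.mem_filter, Finset.mem_Icc]
      rw [hS y _ (mem_cells.2 ⟨⟨h1, h2⟩, by omega⟩), show k + 1 - (k + 1 - c) = c by omega]
      omega
  have := Finset.card_filter_add_card_filter_not (s := Finset.Icc 1 k)
    (fun c => T (n + 1 - y, c) ≤ (n : ℤ) * k - t)
  rw [Nat.card_Icc, Nat.add_sub_cancel] at this
  rw [e, rowCount]
  omega

lemma IsArc.rotate
    (hS : ∀ y c, (y, c) ∈ cells n k → S (y, c) = (n : ℤ) * k + 1 - T (n + 1 - y, k + 1 - c))
    (h1 : 1 ≤ x) (h2 : x < n) {i j : ℤ} (h : IsArc k T x i j) :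
    IsArc k S (n - x) ((n : ℤ) * k + 1 - j) ((n : ℤ) * k + 1 - i) := by
  have hex : ∀ t, excess k S (n - x) t = excess k T x ((n : ℤ) * k - t) := by
    intro t
    rw [excess, excess, rowCount_rotate hS (by omega) (by omega),
      rowCount_rotate hS (by omega) (by omega), show n + 1 - (n - x) = x + 1 by omega,
      show n + 1 - (n - x + 1) = x by omega]
    ring
  have hcell : ∀ y t, 1 ≤ y → y ≤ n → (∃ c, 1 ≤ c ∧ c ≤ k ∧ T (y, c) = t) →
      ∃ c, 1 ≤ c ∧ c ≤ k ∧ S (n + 1 - y, c) = (n : ℤ) * k + 1 - t := by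
    rintro y t a b ⟨c, hc1, hck, rfl⟩
    refine ⟨k + 1 - c, by omega, by omega, ?_⟩
    rw [hS _ _ (mem_cells.2 (by omega)), show n + 1 - (n + 1 - y) = y by omega,
      show k + 1 - (k + 1 - c) = c by omega]
  have hi := hcell x i h1 h2.le h.mem_left
  have hj := hcell (x + 1) j (by omega) h2 h.mem_right
  rw [show n + 1 - x = n - x + 1 by omega] at hi
  rw [show n + 1 - (x + 1) = n - x by omega] at hj
  have hb := h.balanced
  refine ⟨hj, hi, by have := h.lt; omega, ?_, fun t a b => ?_⟩
  · rw [hex, hex, show (n : ℤ) * k - ((n : ℤ) * k + 1 - i - 1) = i by ring,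
      show (n : ℤ) * k - ((n : ℤ) * k + 1 - j) = j - 1 by ring, hb]
  · rw [hex, hex, show (n : ℤ) * k - ((n : ℤ) * k + 1 - j) = j - 1 by ring, hb]
    exact h.le _ (by omega) (by omega)

end Arcs

end RectTableau

theorem mainTheorem2 (n k : ℕ) (T : RectTableau.Filling) (hT : RectTableau.IsSYT n k T) :
    RectTableau.IsSYT n k (RectTableau.evacuation n k T) ∧
    (∀ x : ℕ, 1 ≤ x → x < n → ∀ i j : ℤ,
      (x, i, j) ∈ RectTableau.matching n k T ↔
        (n - x, (n : ℤ) * k + 1 - j, (n : ℤ) * k + 1 - i) ∈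
          RectTableau.matching n k (RectTableau.evacuation n k T)) ∧
    RectTableau.reflection n ((n : ℤ) * k) (RectTableau.matching n k T) =
      RectTableau.matching n k (RectTableau.evacuation n k T) := by
  have hS := fun y c (h : (y, c) ∈ RectTableau.cells n k) => hT.evacuation_eq h
  have hE := hT.of_eq_rotate hS
  have hS' : ∀ y c, (y, c) ∈ RectTableau.cells n k →
      T (y, c) = (n : ℤ) * k + 1 - RectTableau.evacuation n k T (n + 1 - y, k + 1 - c) := by
    intro y c h
    rw [RectTableau.mem_cells] at h
    rw [hS _ _ (RectTableau.mem_cells.2 (by omega)), show n + 1 - (n + 1 - y) = y by omega,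
      show k + 1 - (k + 1 - c) = c by omega]
    ring
  have hiff : ∀ x : ℕ, 1 ≤ x → x < n → ∀ i j : ℤ,
      (x, i, j) ∈ RectTableau.matching n k T ↔
        (n - x, (n : ℤ) * k + 1 - j, (n : ℤ) * k + 1 - i) ∈
          RectTableau.matching n k (RectTableau.evacuation n k T) := by
    intro x h1 h2 i j
    rw [hT.mem_matching h1 h2, hE.mem_matching (by omega) (by omega)]
    refine ⟨RectTableau.IsArc.rotate hS h1 h2, fun h => ?_⟩
    have := RectTableau.IsArc.rotate hS' (by omega) (by omega) h
    rwa [show n - (n - x) = x by omega, sub_sub_cancel, sub_sub_cancel] at this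
  refine ⟨hE, hiff, Set.ext ?_⟩
  rintro ⟨x, i, j⟩
  simp only [RectTableau.reflection, Set.mem_image, Prod.exists, Prod.mk.injEq]
  constructor
  · rintro ⟨x', i', j', h, rfl, rfl, rfl⟩
    exact (hiff x' h.1 h.2.1 i' j').1 h
  · intro h
    have hx : 1 ≤ x := h.1
    have hxn : x < n := h.2.1
    refine ⟨n - x, (n : ℤ) * k + 1 - j, (n : ℤ) * k + 1 - i, ?_, by omega, by ring, by ring⟩
    rw [hiff (n - x) (by omega) (by omega), show n - (n - x) = x by omega, sub_sub_cancel,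
      sub_sub_cancel]
    exact h
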